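/- A group is locally finite if all its finitely generated subgroups are finite. Hall's group is the Fraïssé limit of the class of finite groups, i.e. the countable locally finite group $G$ (unique up to isomorphism) such that for all finite groups $A,B$ and injective homomorphisms $\iota:A\to B$, $\rho:A\to G$ there is an injective homomorphism $\sigma:B\to G$ with $\sigma\circ\iota=\rho$. The rational Urysohn space is the Fraïssé limit of the class of finite metric spaces with rational distances, i.e. the countable metric space $D$ with rational distances (unique up to isometry) such that for all finite metric spaces $A,B$ with rational distances and isometric embeddings $\iota:A\to B$, $\rho:A\to D$ there is an isometric embedding $\sigma:B\to D$ with $\sigma\circ\iota=\rho$. The Urysohn space $\mathbb{U}$ is its completion. For a metric space $X$ with a base point $o$, the Lipschitz-free space $F(X)$ is the closed linear span of the evaluation functionals $f\mapsto f(x)$, $x\in X$, in the dual of the Banach space $\mathrm{Lip}_0(X)$ of real Lipschitz functions vanishing at $o$, normed by the least Lipschitz constant. The Holmes space is $F(\mathbb{U})$. **Corollary (Holmes space).** Hall's group $G$ and the Urysohn space $\mathbb{U}$ exist and, for every choice of the base point of $\mathbb{U}$, there is an action $\alpha$ of $G$ on the Holmes space $F(\mathbb{U})$ by affine isometries such that the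 following holds. For every countable locally finite group $H$, every separable real Banach space $Y$ and every action of $H$ on $Y$ by (surjective) isometries there are a subgroup $H'\le G$, a group isomorphism $e:H\to H'$ and an isometric embedding $j:Y\to F(\mathbb{U})$ (as metric spaces; $j$ need not be affine) with $$j(h\cdot y)=\alpha(e(h))\,j(y)\qquad\text{for all } h\in H,\ y\in Y.$$ -/

import Mathlib

/-- A group is locally finite if all its finitely generated subgroups are finite. -/
def IsLocallyFiniteGroup (G : Type*) [Group G] : Prop :=
  ∀ K : Subgroup G, K.FG → Finite K

/-- `G` is Hall's universal locally finite group, i.e. the Fraïssé limit of the class of finite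
groups: it is countable, locally finite, and has the extension property for finite groups.
(With `A` trivial, the extension property says that every finite group embeds into `G`.) -/
structure IsHallGroup (G : Type*) [Group G] : Prop where
  countable : Countable G
  locallyFinite : IsLocallyFiniteGroup G
  extension : ∀ (A B : Type) [Group A] [Group B] [Finite A] [Finite B]
    (ι : A →* B) (ρ : A →* G), Function.Injective ι → Function.Injective ρ →
      ∃ σ : B →* G, Function.Injective σ ∧ σ.comp ι = ρ

/-- All distances in the metric space are rational numbers. -/
def HasRationalDistances (X : Type*) [MetricSpace X] : Prop :=
  ∀ x y : X, ∃ q : ℚ, dist x y = q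

/-- `D` is the rational Urysohn space, i.e. the Fraïssé limit of the class of finite metric spaces
with rational distances.  (With `A` empty, the extension property says that every finite rational
metric space embeds into `D`.) -/
structure IsRationalUrysohnSpace (D : Type*) [MetricSpace D] : Prop where
  countable : Countable D
  rational : HasRationalDistances D
  extension : ∀ (A B : Type) [MetricSpace A] [MetricSpace B] [Finite A] [Finite B],
    HasRationalDistances A → HasRationalDistances B →
    ∀ (ι : A → B) (ρ : A → D), Isometry ι → Isometry ρ →
      ∃ σ : B → D, Isometry σ ∧ σ ∘ ι = ρ

/-- `U` is the Urysohn universal space: the completion of the rational Urysohn space, i.e. a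
complete metric space with a dense copy of the rational Urysohn space. -/
structure IsUrysohnSpace (U : Type*) [MetricSpace U] : Prop where
  complete : CompleteSpace U
  exists_dense : ∃ D : Set U, Dense D ∧ IsRationalUrysohnSpace D

/-- The linear space of real Lipschitz functions on `X` that vanish at the base point `o`. -/
def lipZeroSubmodule (X : Type*) [MetricSpace X] (o : X) : Submodule ℝ (X → ℝ) where
  carrier := {f | f o = 0 ∧ ∃ K : NNReal, LipschitzWith K f}
  zero_mem' := ⟨rfl, 0, LipschitzWith.const 0⟩
  add_mem' := by
    rintro f g ⟨hf, K, hK⟩ ⟨hg, L, hL⟩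
    exact ⟨by simp [hf, hg], K + L, hK.add hL⟩
  smul_mem' := by
    rintro c f ⟨hf, K, hK⟩
    refine ⟨by simp [hf], ‖c‖₊ * K, LipschitzWith.of_dist_le_mul fun x y => ?_⟩
    have h := hK.dist_le_mul x y
    simp only [Pi.smul_apply, dist_smul₀, NNReal.coe_mul, coe_nnnorm, mul_assoc]
    exact mul_le_mul_of_nonneg_left h (norm_nonneg c)

/-- `Lip₀(X, o)`: real Lipschitz functions on `X` vanishing at `o`, to be normed by the best
Lipschitz constant. -/
def LipZero (X : Type*) [MetricSpace X] (o : X) : Type _ := ↥(lipZeroSubmodule X o)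

namespace LipZero

variable {X : Type*} [MetricSpace X] {o : X}

instance : AddCommGroup (LipZero X o) := inferInstanceAs (AddCommGroup ↥(lipZeroSubmodule X o))

instance : Module ℝ (LipZero X o) := inferInstanceAs (Module ℝ ↥(lipZeroSubmodule X o))

instance : CoeFun (LipZero X o) (fun _ => X → ℝ) := ⟨fun f => f.1⟩

@[simp] theorem add_apply (f g : LipZero X o) (x : X) : (f + g) x = f x + g x := rfl

@[simp] theorem smul_apply (c : ℝ) (f : LipZero X o) (x : X) : (c • f) x = c * f x := rfl

@[simp] theorem zero_apply (x : X) : (0 : LipZero X o) x = 0 := rfl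

theorem apply_base (f : LipZero X o) : f o = 0 := f.2.1

theorem ext_apply {f g : LipZero X o} (h : ∀ x, f x = g x) : f = g := Subtype.ext (funext h)

/-- The set of all Lipschitz constants of `f`. -/
def lipConstants (f : LipZero X o) : Set ℝ :=
  {K | 0 ≤ K ∧ ∀ x y, |f x - f y| ≤ K * dist x y}

/-- The norm of `Lip₀(X, o)`: the least Lipschitz constant. -/
noncomputable instance : Norm (LipZero X o) := ⟨fun f => sInf (lipConstants f)⟩

theorem norm_def (f : LipZero X o) : ‖f‖ = sInf (lipConstants f) := rfl

theorem lipConstants_nonempty (f : LipZero X o) : (lipConstants f).Nonempty := by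
  obtain ⟨K, hK⟩ := f.2.2
  exact ⟨K, K.2, fun x y => by simpa [Real.dist_eq] using hK.dist_le_mul x y⟩

theorem lipConstants_bddBelow (f : LipZero X o) : BddBelow (lipConstants f) :=
  ⟨0, fun _ hK => hK.1⟩

theorem norm_nonneg' (f : LipZero X o) : 0 ≤ ‖f‖ :=
  Real.sInf_nonneg fun _ hK => hK.1

theorem abs_sub_le (f : LipZero X o) (x y : X) : |f x - f y| ≤ ‖f‖ * dist x y := by
  rcases eq_or_lt_of_le (dist_nonneg (x := x) (y := y)) with h | h
  · obtain ⟨K, hK⟩ := lipConstants_nonempty f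
    have := hK.2 x y
    rw [← h, mul_zero] at this ⊢
    exact this
  · rw [← div_le_iff₀ h]
    exact le_csInf (lipConstants_nonempty f) fun K hK => (div_le_iff₀ h).2 (hK.2 x y)

theorem norm_le {f : LipZero X o} {K : ℝ} (hK : 0 ≤ K)
    (h : ∀ x y, |f x - f y| ≤ K * dist x y) : ‖f‖ ≤ K :=
  csInf_le (lipConstants_bddBelow f) ⟨hK, h⟩

theorem norm_smul_le' (c : ℝ) (f : LipZero X o) : ‖c • f‖ ≤ |c| * ‖f‖ := by
  refine norm_le (mul_nonneg (abs_nonneg c) (norm_nonneg' f)) fun x y => ?_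
  rw [smul_apply, smul_apply, ← mul_sub, abs_mul, mul_assoc]
  exact mul_le_mul_of_nonneg_left (abs_sub_le f x y) (abs_nonneg c)

theorem normCore : NormedSpace.Core ℝ (LipZero X o) where
  norm_nonneg := norm_nonneg'
  norm_smul c f := by
    refine le_antisymm (norm_smul_le' c f) ?_
    rcases eq_or_ne c 0 with rfl | hc
    · simpa using norm_nonneg' _
    · have h := norm_smul_le' c⁻¹ (c • f)
      rw [inv_smul_smul₀ hc, abs_inv, inv_mul_eq_div, le_div_iff₀ (abs_pos.2 hc)] at h
      rw [Real.norm_eq_abs, mul_comm]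
      exact h
  norm_triangle f g := by
    refine norm_le (add_nonneg (norm_nonneg' f) (norm_nonneg' g)) fun x y => ?_
    calc |(f + g) x - (f + g) y| = |(f x - f y) + (g x - g y)| := by
          rw [add_apply, add_apply]; congr 1; ring
      _ ≤ |f x - f y| + |g x - g y| := abs_add_le _ _
      _ ≤ (‖f‖ + ‖g‖) * dist x y := by
          rw [add_mul]; exact add_le_add (abs_sub_le f x y) (abs_sub_le g x y)
  norm_eq_zero_iff f := by
    constructor
    · intro h
      refine ext_apply fun x => ?_
      have h1 := abs_sub_le f x o
      rw [h, zero_mul, apply_base, sub_zero] at h1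
      exact abs_eq_zero.1 (le_antisymm h1 (abs_nonneg _))
    · rintro rfl
      exact le_antisymm (norm_le le_rfl (by simp)) (norm_nonneg' _)

noncomputable instance : NormedAddCommGroup (LipZero X o) := NormedAddCommGroup.ofCore normCore

noncomputable instance : NormedSpace ℝ (LipZero X o) := NormedSpace.ofCore normCore

/-- The evaluation functional `f ↦ f x` on `Lip₀(X, o)`. -/
noncomputable def eval (o x : X) : StrongDual ℝ (LipZero X o) :=
  LinearMap.mkContinuous
    { toFun := fun f => f x
      map_add' := fun _ _ => rfl
      map_smul' := fun _ _ => rfl }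
    (dist x o) (fun f => by
      have h := abs_sub_le f x o
      rw [apply_base, sub_zero, mul_comm] at h
      exact h)

end LipZero

/-- The Lipschitz-free Banach space `F(X)` over the pointed metric space `(X, o)`: the closed
linear span of the evaluation functionals in the dual of `Lip₀(X, o)`. -/
abbrev LipschitzFreeSpace (X : Type*) [MetricSpace X] (o : X) : Type _ :=
  ↥((Submodule.span ℝ (Set.range (LipZero.eval o))).topologicalClosure)

/-- The group (under composition) of all affine isometries of the real normed space `E` onto
itself. -/
abbrev AffineIsometryGroup (E : Type*) [NormedAddCommGroup E] [NormedSpace ℝ E] : Type _ :=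
  E ≃ᵃⁱ[ℝ] E

/-! A surjective isometry T of a pointed metric space X acts on its Lipschitz-free space.
Precomposition with T, corrected at the base point o, dualizes to a linear isometry sending δ_x to
δ_{Tx} - δ_{To}; adding the translation by δ_{To} gives an affine isometry with δ_x ↦ δ_{Tx}. This
is multiplicative in T (`LipschitzFreeSpace.affineAction`), and x ↦ δ_x is isometric. So it suffices
to let Hall's group G act on the Urysohn space U in such a way that every isometric action of a
countable locally finite group on a separable metric space embeds (`exists_universal_action`).

That action comes from a generic left-invariant rational metric on G × ℕ, a Fraïssé limit of
invariant metrics on finitely many copies of finite subgroups of G. It meets countably many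
requirements: new orbits with prescribed distances, and finite overgroups with prescribed metrics.
New orbits alone already give the one-point extension property, so G × ℕ is the rational Urysohn
space and, by back-and-forth, sits densely in U. Both kinds together embed every invariant rational
metric on H × ℕ for H countable and locally finite (`IsGenericInvMetric.exists_embedding`).

The heart is the amalgamation of invariant metrics on finite groups over a common subgroup
(`exists_amalgam_nat`). On the amalgamated product one takes the path metric. Reducing a word does
not raise its cost, by the triangle inequality, and the normal form theorem then shows that elements
of a factor keep their prescribed distances. The amalgam may be infinite, but for integral distances
bounded by R only words of length at most R matter, and a finite permutation representation sees
these faithfully (`exists_finite_perm_of_amalgam`). Truncating the path metric at R + 1 yields a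
metric on a finite group, which the extension property of G places inside G.

Real distances and non-free actions are reached by approximation: distances are rounded up to
multiples of 2⁻ᵐ and 2⁻ᵐ is added between distinct formal points. The levels m are glued into one
invariant rational metric in which the copies of a point form a Cauchy sequence
(`exists_invMetric_approx`); limits in U recover the given action. -/

open Equiv

/-! ### Free actions of finite groups on finite sets -/

/-- A free action of a finite group splits as a disjoint union of copies of the regular action. -/
theorem exists_equiv_prod_of_free.{u, v} {A : Type u} {E : Type v} [Group A] [Finite E] (ρ : A →* Perm E)
    (hρ : ∀ a e, ρ a e = e → a = 1) :
    ∃ (Q : Type v) (_ : Finite Q) (θ : A × Q ≃ E), ∀ a b q, θ (a * b, q) = ρ a (θ (b, q)) := by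
  let S : Setoid E :=
    { r := fun x y => ∃ a, ρ a x = y
      iseqv := ⟨fun x => ⟨1, by simp⟩, fun {x y} ⟨a, h⟩ => ⟨a⁻¹, by simp [← h]⟩,
        fun {x y z} ⟨a, h⟩ ⟨b, h'⟩ => ⟨b * a, by simp [h, h']⟩⟩ }
  refine ⟨Quotient S, inferInstance, Equiv.ofBijective (fun p => ρ p.1 p.2.out) ⟨?_, ?_⟩, ?_⟩
  · rintro ⟨a, q⟩ ⟨b, r⟩ h
    change ρ a (Quotient.out q) = ρ b (Quotient.out r) at h
    have hqr : q = r := by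
      rw [← Quotient.out_eq q, ← Quotient.out_eq r]
      refine Quotient.sound ⟨b⁻¹ * a, ?_⟩
      rw [map_mul, Perm.mul_apply, h, map_inv, Perm.inv_def, Equiv.symm_apply_apply]
    subst hqr
    have : b⁻¹ * a = 1 := hρ _ (Quotient.out q) (by
      rw [map_mul, Perm.mul_apply, h, map_inv, Perm.inv_def, Equiv.symm_apply_apply])
    rw [inv_mul_eq_one] at this
    rw [this]
  · intro e
    obtain ⟨a, ha⟩ : ∃ a, ρ a (Quotient.out (s := S) ⟦e⟧) = e := Quotient.exact (s := S) (Quotient.out_eq _)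
    exact ⟨(a, ⟦e⟧), ha⟩
  · intro a b q
    change ρ (a * b) q.out = ρ a (ρ b q.out)
    rw [map_mul, Perm.mul_apply]

/-- Both sets are multiples of the regular action, and the cardinality determines the number of
copies. -/
theorem exists_equivariant_equiv_of_free {A E F : Type*} [Group A] [Finite A] [Finite E] [Finite F]
    (ρ : A →* Perm E) (hρ : ∀ a e, ρ a e = e → a = 1)
    (σ : A →* Perm F) (hσ : ∀ a e, σ a e = e → a = 1) (hc : Nat.card E = Nat.card F) :
    ∃ θ : E ≃ F, ∀ a e, θ (ρ a e) = σ a (θ e) := by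
  obtain ⟨Q, _, u, hu⟩ := exists_equiv_prod_of_free ρ hρ
  obtain ⟨R, _, v, hv⟩ := exists_equiv_prod_of_free σ hσ
  have hQR : Nat.card Q = Nat.card R := by
    rw [← Nat.card_congr u, ← Nat.card_congr v, Nat.card_prod, Nat.card_prod] at hc
    exact Nat.eq_of_mul_eq_mul_left Nat.card_pos hc
  let t : Q ≃ R := Classical.choice ((Finite.card_eq).1 hQR)
  refine ⟨(u.symm.trans ((Equiv.refl A).prodCongr t)).trans v, fun a e => ?_⟩
  obtain ⟨⟨b, q⟩, rfl⟩ := u.surjective e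
  rw [← hu]
  simp [hv]

/-- A free action of a subgroup extends to the whole group as soon as the cardinality allows it. -/
theorem exists_perm_hom_extending {A B E : Type*} [Group A] [Group B] [Finite B] [Finite E]
    (ι : A →* B) (hι : Function.Injective ι) (ρ : A →* Perm E) (hρ : ∀ a e, ρ a e = e → a = 1)
    (hd : Nat.card B ∣ Nat.card E) :
    ∃ σ : B →* Perm E, (∀ a, σ (ι a) = ρ a) ∧ ∀ b e, σ b e = e → b = 1 := by
  obtain ⟨m, hm⟩ := hd
  have : Finite A := Finite.of_injective ι hι
  -- The model is `m` copies of the regular action of `B`. Restricted along `ι` it is a free `A`-set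
  -- of the size of `E`, hence isomorphic to `E`, and the isomorphism carries the `B`-action over.
  let lam : B →* Perm (B × Fin m) :=
    { toFun := fun b => (Equiv.mulLeft b).prodCongr (Equiv.refl _)
      map_one' := by ext x <;> simp
      map_mul' := fun a b => by ext x <;> simp [mul_assoc] }
  obtain ⟨θ, hθ⟩ := exists_equivariant_equiv_of_free ρ hρ (lam.comp ι) (fun a e h => by
      have h1 := congrArg Prod.fst h
      simp only [lam, MonoidHom.comp_apply, MonoidHom.coe_mk, OneHom.coe_mk, Equiv.prodCongr_apply,
        Prod.map_fst, Equiv.coe_mulLeft, mul_eq_right] at h1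
      exact hι (h1.trans ι.map_one.symm)) (by simp [hm])
  refine ⟨(θ.symm.permCongrHom.toMonoidHom).comp lam, fun a => ?_, fun b e h => ?_⟩
  · ext e
    have := hθ a e
    simp [Equiv.permCongrHom, Equiv.permCongr_apply] at this ⊢
    rw [← this]
    simp
  · replace h : θ.symm (lam b (θ e)) = e := h
    rw [Equiv.symm_apply_eq] at h
    exact mul_eq_right.1 (congrArg Prod.fst h)

/-- An action of `B` on an invariant part of a finite set which carries a free action of the
subgroup `A` extends to the whole set. -/
theorem exists_perm_hom_extending_partial {A B E : Type*} [Group A] [Group B] [Finite B] [Finite E]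
    (ι : A →* B) (hι : Function.Injective ι) (ρ : A →* Perm E) (hρ : ∀ a e, ρ a e = e → a = 1)
    (p : E → Prop) (π : B →* Perm {e // p e}) (hπ : ∀ a e, (π (ι a) e : E) = ρ a e)
    (hd : Nat.card B ∣ Nat.card {e // ¬ p e}) :
    ∃ σ : B →* Perm E, (∀ a, σ (ι a) = ρ a) ∧ ∀ b (e : {e // p e}), σ b e = π b e := by
  classical
  have hp : ∀ a e, p (ρ a e) ↔ p e := by
    have h1 : ∀ a e, p e → p (ρ a e) := fun a e he => by
      rw [← hπ a ⟨e, he⟩]; exact (π (ι a) ⟨e, he⟩).2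
    refine fun a e => ⟨fun h => ?_, h1 a e⟩
    simpa using h1 a⁻¹ _ h
  let ρ' : A →* Perm {e // ¬ p e} :=
    { toFun := fun a => (ρ a).subtypePerm (fun e => by simp [hp])
      map_one' := by ext; simp
      map_mul' := fun a b => Equiv.ext fun x => Subtype.ext (by
        change ρ (a * b) x = ρ a (ρ b x)
        rw [map_mul, Perm.mul_apply]) }
  -- The complement of `p` is invariant and free under `A` as well, so the action extends there; the
  -- two actions of `B` are then glued.
  obtain ⟨σ', hσ', -⟩ := exists_perm_hom_extending ι hι ρ' (fun a e h => hρ a e (by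
      have := congrArg Subtype.val h
      simpa [ρ'] using this)) hd
  refine ⟨(Perm.subtypeCongrHom p).comp (π.prod σ'), fun a => ?_, fun b e => ?_⟩
  · ext e
    by_cases he : p e
    · simp [Perm.subtypeCongrHom, he, hπ]
    · simp [Perm.subtypeCongrHom, he, hσ', ρ']
  · simp [Perm.subtypeCongrHom, e.2]

/-! ### Invariant metrics and the cost of paths in an amalgam -/

/-- `w` is the matrix-valued length function of a left-invariant metric on `K × I`, where
`w g i j` is the distance from `(1, i)` to `(g, j)`. -/
structure IsInvMetric {G ι R : Type*} [Group G] [AddCommMonoid R] [PartialOrder R]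
    (K : Subgroup G) (I : Set ι) (w : G → ι → ι → R) : Prop where
  eq_zero_iff : ∀ g ∈ K, ∀ i ∈ I, ∀ j ∈ I, (w g i j = 0 ↔ g = 1 ∧ i = j)
  symm : ∀ g ∈ K, ∀ i ∈ I, ∀ j ∈ I, w g⁻¹ j i = w g i j
  triangle : ∀ g ∈ K, ∀ h ∈ K, ∀ i ∈ I, ∀ j ∈ I, ∀ k ∈ I, w (g * h) i k ≤ w g i j + w h j k

/-- `WPath ψ w I c x n`: multiplying letters from the groups `L k` one can get from the point
`(1, i)` to the point `(x, c)` at total cost `n`. -/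
inductive WPath {κ ι Γ : Type*} {L : κ → Type*} [∀ k, Group (L k)] [Group Γ]
    (ψ : ∀ k, L k →* Γ) (w : ∀ k, L k → ι → ι → ℕ) (c : ι) : Γ → ι → ℕ → Prop
  | nil : WPath ψ w c 1 c 0
  | cons {x : Γ} {j : ι} {n : ℕ} (k : κ) (g : L k) (i : ι) (h : WPath ψ w c x j n) :
      WPath ψ w c (ψ k g * x) i (w k g i j + n)

namespace WPath

variable {κ ι Γ : Type*} {L : κ → Type*} [∀ k, Group (L k)] [Group Γ]
    {ψ : ∀ k, L k →* Γ} {w : ∀ k, L k → ι → ι → ℕ}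

theorem single (k : κ) (g : L k) (i j : ι) : WPath ψ w j (ψ k g) i (w k g i j) := by
  simpa using WPath.cons k g i (WPath.nil (ψ := ψ) (w := w) (c := j))

theorem append {c d : ι} {x y : Γ} {i : ι} {m n : ℕ} (h : WPath ψ w c x i m)
    (h' : WPath ψ w d y c n) : WPath ψ w d (x * y) i (m + n) := by
  induction h with
  | nil => simpa using h'
  | cons k g i h ih => rw [mul_assoc, add_assoc]; exact ih.cons k g i

theorem reverse (hw : ∀ k, IsInvMetric ⊤ Set.univ (w k)) {c : ι} {x : Γ} {i : ι} {n : ℕ}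
    (h : WPath ψ w c x i n) : WPath ψ w i x⁻¹ c n := by
  induction h with
  | nil => simpa using WPath.nil
  | @cons x j n k g i h ih =>
    have h1 := ih.append (single (ψ := ψ) (w := w) k g⁻¹ j i)
    rw [(hw k).symm g trivial i trivial j trivial, map_inv, add_comm, ← mul_inv_rev] at h1
    exact h1

theorem eq_of_zero (hw : ∀ k, IsInvMetric ⊤ Set.univ (w k)) {c : ι} {x : Γ} {i : ι} {n : ℕ}
    (h : WPath ψ w c x i n) (hn : n = 0) : x = 1 ∧ i = c := by
  induction h with
  | nil => exact ⟨rfl, rfl⟩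
  | @cons x j n k g i h ih =>
    obtain ⟨rfl, rfl⟩ := ih (by omega)
    obtain ⟨rfl, rfl⟩ := ((hw k).eq_zero_iff g trivial i trivial j trivial).1 (by omega)
    simp

end WPath

/-- Reduced paths: the letters alternate between the groups and, except possibly for the last one,
lie outside of the common subgroup. -/
inductive ReducedWPath {κ ι Γ A : Type*} {L : κ → Type*} [∀ k, Group (L k)] [Group Γ] [Group A]
    (φ : ∀ k, A →* L k) (ψ : ∀ k, L k →* Γ) (w : ∀ k, L k → ι → ι → ℕ) (c : ι) (k₀ : κ) :
    κ → Γ → ι → ℕ → Prop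
  | base (g : L k₀) (i : ι) : ReducedWPath φ ψ w c k₀ k₀ (ψ k₀ g) i (w k₀ g i c)
  | cons {k' : κ} {x : Γ} {j : ι} {n : ℕ} (k : κ) (hk : k ≠ k') (g : L k) (hg : g ∉ (φ k).range)
      (i : ι) (h : ReducedWPath φ ψ w c k₀ k' x j n) :
      ReducedWPath φ ψ w c k₀ k (ψ k g * x) i (w k g i j + n)

section Reduced

variable {κ ι Γ A : Type*} {L : κ → Type*} [∀ k, Group (L k)] [Group Γ] [Group A]
    {φ : ∀ k, A →* L k} {ψ : ∀ k, L k →* Γ} {w : ∀ k, L k → ι → ι → ℕ}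

/-- A letter of the common subgroup lies in every factor, at the same cost, so it can be multiplied
into the first letter. The triangle inequality bounds the new cost, and a first letter outside the
common subgroup stays outside. -/
theorem ReducedWPath.absorb (hψ : ∀ k l a, ψ k (φ k a) = ψ l (φ l a))
    (hw : ∀ k, IsInvMetric ⊤ Set.univ (w k)) (hwA : ∀ k l a i j, w k (φ k a) i j = w l (φ l a) i j)
    {c : ι} {k₀ k : κ} {x : Γ} {j : ι} {n : ℕ} (h : ReducedWPath φ ψ w c k₀ k x j n)
    (l : κ) (a : A) (i : ι) :
    ∃ n' ≤ w l (φ l a) i j + n, ReducedWPath φ ψ w c k₀ k (ψ l (φ l a) * x) i n' := by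
  cases h with
  | base g =>
    refine ⟨w k₀ (φ k₀ a * g) i c, ?_, ?_⟩
    · rw [hwA l k₀]
      exact (hw k₀).triangle _ trivial _ trivial _ trivial _ trivial _ trivial
    · rw [hψ l k₀, ← map_mul]
      exact .base _ _
  | @cons k' y j' n' _ hk g hg _ h =>
    refine ⟨w k (φ k a * g) i j' + n', ?_, ?_⟩
    · rw [hwA l k, ← add_assoc]
      exact Nat.add_le_add_right
        ((hw k).triangle _ trivial _ trivial _ trivial _ trivial _ trivial) _
    · rw [hψ l k, ← mul_assoc, ← map_mul]
      refine .cons k hk _ (fun h' => hg ?_) i h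
      simpa using (φ k).range.mul_mem (inv_mem (MonoidHom.mem_range.2 ⟨a, rfl⟩)) h'

/-- Neighbouring letters of one factor are multiplied and letters of the common subgroup are
absorbed; neither raises the cost. The final letter is unrestricted, possibly trivial, so its factor
`k₀` can be chosen at will. -/
theorem WPath.exists_reduced (hψ : ∀ k l a, ψ k (φ k a) = ψ l (φ l a))
    (hw : ∀ k, IsInvMetric ⊤ Set.univ (w k)) (hwA : ∀ k l a i j, w k (φ k a) i j = w l (φ l a) i j)
    {c : ι} (k₀ : κ) {x : Γ} {i : ι} {n : ℕ} (h : WPath ψ w c x i n) :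
    ∃ k, ∃ n' ≤ n, ReducedWPath φ ψ w c k₀ k x i n' := by
  induction h with
  | nil =>
    refine ⟨k₀, 0, le_rfl, ?_⟩
    have := ReducedWPath.base (φ := φ) (ψ := ψ) (w := w) (c := c) (k₀ := k₀) 1 c
    rwa [((hw k₀).eq_zero_iff 1 trivial c trivial c trivial).2 ⟨rfl, rfl⟩, map_one] at this
  | @cons x j n l g i h ih =>
    obtain ⟨k, m, hm, h⟩ := ih
    by_cases hg : g ∈ (φ l).range
    · obtain ⟨a, rfl⟩ := hg
      obtain ⟨m', hm', h'⟩ := h.absorb hψ hw hwA l a i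
      exact ⟨k, m', by omega, h'⟩
    by_cases hlk : l = k
    · subst hlk
      cases h with
      | base g' =>
        refine ⟨k₀, w k₀ (g * g') i c, ?_, ?_⟩
        swap
        · rw [← map_mul]
          exact .base _ _
        have := (hw k₀).triangle g trivial g' trivial i trivial j trivial c trivial
        omega
      | @cons k' y j' n' _ hk g' hg' _ h₂ =>
        have h3 := (hw l).triangle g trivial g' trivial i trivial j trivial j' trivial
        rw [← mul_assoc, ← map_mul]
        by_cases hgg : g * g' ∈ (φ l).range
        · obtain ⟨a, ha⟩ := hgg
          obtain ⟨m', hm', h'⟩ := h₂.absorb hψ hw hwA l a i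
          rw [ha] at hm' h'
          exact ⟨k', m', by omega, h'⟩
        · exact ⟨l, _, by omega, .cons l hk _ hgg i h₂⟩
    · exact ⟨l, _, by omega, .cons l hlk g hg i h⟩

end Reduced

open Monoid in
/-- A reduced path in the amalgamated product which ends in the factor it starts in is a single
letter. -/
theorem ReducedWPath.le_of_eq_of {κ ι A : Type*} {L : κ → Type*} [∀ k, Group (L k)] [Group A]
    {φ : ∀ k, A →* L k} (hφ : ∀ k, Function.Injective (φ k)) {w : ∀ k, L k → ι → ι → ℕ}
    {c : ι} {k₀ k : κ} {x : PushoutI φ} {i : ι} {n : ℕ}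
    (h : ReducedWPath φ (fun k => PushoutI.of k) w c k₀ k x i n)
    (g : L k₀) (hx : x = PushoutI.of k₀ g) : w k₀ g i c ≤ n := by
  classical
  -- A right factor `f` from `L k₀` is carried through the induction: unless the path is a single
  -- letter, `x * f` is spelled by a nonempty alternating word avoiding the common subgroup. If the
  -- last letter times `f` falls into that subgroup, it is absorbed by its predecessor.
  have key : ∀ {k : κ} {x : PushoutI φ} {i : ι} {n : ℕ},
      ReducedWPath φ (fun k => PushoutI.of k) w c k₀ k x i n → ∀ f : L k₀,
      (k = k₀ ∧ ∃ g, x = PushoutI.of k₀ g ∧ n = w k₀ g i c) ∨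
      ∃ l : List (Σ k, L k), l.IsChain (fun a b => a.1 ≠ b.1) ∧ (∀ a ∈ l, a.2 ∉ (φ a.1).range) ∧
        (∃ a ∈ l.head?, a.1 = k) ∧ (l.map fun a => (PushoutI.of a.1 a.2 : PushoutI φ)).prod =
          x * PushoutI.of k₀ f := by
    intro k x i n h f
    induction h with
    | base g i => exact Or.inl ⟨rfl, g, rfl, rfl⟩
    | @cons k' y j' n' k hk g' hg' i h ih =>
      right
      rcases ih with ⟨rfl, g, rfl, -⟩ | ⟨l, hl, hA, ⟨a, ha, rfl⟩, hprod⟩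
      · by_cases hgf : g * f ∈ (φ k').range
        · obtain ⟨a, ha⟩ := hgf
          refine ⟨[⟨k, g' * φ k a⟩], by simp, ?_, ⟨_, rfl, rfl⟩, ?_⟩
          · simp only [List.mem_singleton, forall_eq]
            exact fun h' => hg' (by
              simpa using (φ k).range.mul_mem h' (inv_mem (MonoidHom.mem_range.2 ⟨a, rfl⟩)))
          · simp [mul_assoc, ← map_mul (PushoutI.of k'), ← ha, PushoutI.of_apply_eq_base]
        · refine ⟨[⟨k, g'⟩, ⟨k', g * f⟩], by simpa using hk, ?_, ⟨_, rfl, rfl⟩, ?_⟩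
          · rintro a ha
            simp only [List.mem_cons, List.not_mem_nil, or_false] at ha
            rcases ha with rfl | rfl
            · exact hg'
            · exact hgf
          · simp [mul_assoc]
      · refine ⟨⟨k, g'⟩ :: l, ?_, ?_, ⟨_, rfl, rfl⟩, ?_⟩
        · rw [List.isChain_cons]
          refine ⟨fun b hb => ?_, hl⟩
          rw [Option.mem_def] at ha hb
          rw [ha] at hb
          cases hb
          exact hk
        · rintro b hb
          rcases List.mem_cons.1 hb with rfl | hb
          · exact hg'
          · exact hA b hb
        · simp [hprod, mul_assoc]
  rcases key h g⁻¹ with ⟨rfl, g', hg', rfl⟩ | ⟨l, hl, hA, ⟨a, ha, -⟩, hprod⟩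
  · rw [PushoutI.of_injective hφ k (hx.symm.trans hg')]
  -- With `f = g⁻¹` the word represents 1, so the normal form theorem makes it empty, although it
  -- has a head.
  · exfalso
    let W : CoprodI.Word L := ⟨l, fun a ha h1 => hA a ha (h1 ▸ one_mem _), hl⟩
    have hW : PushoutI.Reduced φ W := hA
    have h0 := hW.eq_empty_of_mem_range hφ (by
      have : PushoutI.ofCoprodI (φ := φ) W.prod = 1 := by
        rw [hx, map_inv, mul_inv_cancel] at hprod
        rw [← hprod]
        simp [W, CoprodI.Word.prod, map_list_prod, Function.comp_def]
      rw [this]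
      exact one_mem _)
    have h1 : l = [] := congrArg CoprodI.Word.toList h0
    simp [h1] at ha

/-! ### Finite images of amalgams and amalgamation of integral metrics -/

open scoped Pointwise in
/-- The amalgamated product acts on a finite set in such a way that a given finite part of its
regular action is visible. -/
theorem exists_finite_perm_of_amalgam {κ A Γ : Type} {L : κ → Type} [∀ k, Group (L k)]
    [Group Γ] [Group A] [Finite κ] [Nonempty κ] [∀ k, Finite (L k)]
    {φ : ∀ k, A →* L k} (hφ : ∀ k, Function.Injective (φ k))
    {ψ : ∀ k, L k →* Γ} (hψ : ∀ k, Function.Injective (ψ k))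
    (hA : ∀ k l a, ψ k (φ k a) = ψ l (φ l a)) (N : ℕ) :
    ∃ (Ω : Type) (_ : Finite Ω) (χ : ∀ k, L k →* Perm Ω) (e : Γ → Ω) (S : Set Γ),
      (∀ k g, ψ k g ∈ S) ∧ (1 : Γ) ∈ S ∧ (∀ k l a, χ k (φ k a) = χ l (φ l a)) ∧
      Set.InjOn e (S ^ (N + 1)) ∧ ∀ n ≤ N, ∀ k g, ∀ x ∈ S ^ n, χ k g (e x) = e (ψ k g * x) := by
  classical
  let S : Set Γ := ⋃ k, Set.range (ψ k)
  have hS : ∀ k g, ψ k g ∈ S := fun k g => Set.mem_iUnion.2 ⟨k, g, rfl⟩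
  obtain ⟨k₀⟩ := ‹Nonempty κ›
  have h1S : (1 : Γ) ∈ S := (ψ k₀).map_one ▸ hS k₀ 1
  have hSA : ∀ a, ∀ x ∈ S, ψ k₀ (φ k₀ a) * x ∈ S := by
    intro a x hx
    obtain ⟨k, g, rfl⟩ := Set.mem_iUnion.1 hx
    rw [hA k₀ k, ← map_mul]
    exact hS _ _
  have hSfin : S.Finite := Set.finite_iUnion fun k => Set.finite_range _
  let E : Set Γ := S ^ (N + 1)
  have hpow : ∀ n : ℕ, (S ^ n).Finite := fun n => by
    induction n with
    | zero => simp
    | succ n ih => rw [pow_succ]; exact Set.Finite.mul ih hSfin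
  have hEfin : Finite E := (hpow _).to_subtype
  have hEA : ∀ a, ∀ x ∈ E, ψ k₀ (φ k₀ a) * x ∈ E := by
    intro a x hx
    simp only [E, pow_succ'] at hx ⊢
    obtain ⟨s, hs, t, ht, rfl⟩ := Set.mem_mul.1 hx
    rw [← mul_assoc]
    exact Set.mul_mem_mul (hSA a s hs) ht
  -- Taking the product with `J` makes the number of leftover points divisible by the order of every
  -- `L k`, as needed to extend the free action of `A`.
  let J : Type := ∀ k, L k
  let ρ : A →* Perm (E × J) := MonoidHom.toHomPerm
    { toFun := fun a x => (⟨ψ k₀ (φ k₀ a) * x.1, hEA a _ x.1.2⟩, x.2)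
      map_one' := funext fun x => Prod.ext (Subtype.ext (by
        change ψ k₀ (φ k₀ 1) * (x.1 : Γ) = x.1
        simp)) rfl
      map_mul' := fun a b => funext fun x => Prod.ext (Subtype.ext (by
        change ψ k₀ (φ k₀ (a * b)) * (x.1 : Γ) = ψ k₀ (φ k₀ a) * (ψ k₀ (φ k₀ b) * x.1)
        simp [mul_assoc])) rfl }
  have hρ : ∀ a x, ρ a x = (⟨ψ k₀ (φ k₀ a) * x.1, hEA a _ x.1.2⟩, x.2) := fun _ _ => rfl
  -- On the points whose `L k`-orbit stays in `E`, the group `L k` acts by left multiplication.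
  -- Elsewhere only the action of `A` is given, and any extension to `L k` will do.
  let p : κ → E → Prop := fun k x => ∀ g, ψ k g * x ∈ E
  have hp : ∀ k g (x : E), (h : p k x) → p k ⟨ψ k g * x, h g⟩ := fun k g x h f => by
    simp only [← mul_assoc, ← map_mul]
    exact h _
  let π : ∀ k, L k →* Perm {x : E × J // p k x.1} := fun k => MonoidHom.toHomPerm
    { toFun := fun g x => ⟨(⟨ψ k g * x.1.1, x.2 g⟩, x.1.2), hp k g x.1.1 x.2⟩
      map_one' := funext fun x => Subtype.ext <| Prod.ext (Subtype.ext (by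
        change ψ k 1 * (x.1.1 : Γ) = x.1.1
        simp)) rfl
      map_mul' := fun a b => funext fun x => Subtype.ext <| Prod.ext (Subtype.ext (by
        change ψ k (a * b) * (x.1.1 : Γ) = ψ k a * (ψ k b * x.1.1)
        simp [mul_assoc])) rfl }
  have hπ : ∀ k g x, (π k g x : E × J) = (⟨ψ k g * x.1.1, x.2 g⟩, x.1.2) := fun _ _ _ => rfl
  have hext : ∀ k, ∃ σ : L k →* Perm (E × J), (∀ a, σ (φ k a) = ρ a) ∧
      ∀ b (e : {x : E × J // p k x.1}), σ b e = π k b e := by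
    intro k
    refine exists_perm_hom_extending_partial (φ k) (hφ k) ρ ?_ (fun x => p k x.1) (π k) ?_ ?_
    · intro a x h
      rw [hρ] at h
      have h1 : ψ k₀ (φ k₀ a) * x.1 = x.1 := congrArg (fun z => (z.1 : Γ)) h
      rw [mul_eq_right] at h1
      exact (hφ k₀) ((hψ k₀) (by simpa using h1))
    · intro a x
      rw [hπ, hρ]
      ext1
      · exact Subtype.ext (by simp only [hA k k₀ a])
      · rfl
    · rw [Nat.card_congr (Equiv.prodSubtypeFstEquivSubtypeProd (p := fun x => ¬ p k x)),
        Nat.card_prod]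
      refine Dvd.dvd.mul_left ?_ _
      have := Fintype.ofFinite κ
      rw [Nat.card_pi]
      exact Finset.dvd_prod_of_mem (fun k => Nat.card (L k)) (Finset.mem_univ k)
  choose χ hχA hχ using hext
  have h1E : (1 : Γ) ∈ E := Set.one_mem_pow h1S
  refine ⟨E × J, inferInstance, χ, fun x => if h : x ∈ E then (⟨x, h⟩, 1) else (⟨1, h1E⟩, 1), S,
    hS, h1S, fun k l a => by rw [hχA, hχA], ?_, ?_⟩
  · intro x hx y hy h
    have hx' : x ∈ E := hx
    have hy' : y ∈ E := hy
    simpa [hx', hy'] using h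
  · intro n hn k g x hx
    -- A product of `n ≤ N` elements of `S` stays in `E` after one more multiplication; hence the
    -- exponent `N + 1`.
    have hm : ∀ g, ψ k g * x ∈ E := fun g => by
      refine Set.pow_subset_pow_right h1S (Nat.succ_le_succ hn) ?_
      rw [Nat.succ_eq_add_one, pow_succ']
      exact Set.mul_mem_mul (hS k g) hx
    have hxE : x ∈ E := by simpa using hm 1
    have h1 := hχ k g ⟨(⟨x, hxE⟩, 1), hm⟩
    rw [hπ] at h1
    simp only [hxE, hm g, dite_true]
    exact h1

open scoped Pointwise in
/-- Amalgamation of invariant integral metrics over a common subgroup. -/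
theorem exists_amalgam_nat {κ ι A : Type} {L : κ → Type} [∀ k, Group (L k)]
    [Group A] [Finite κ] [Nonempty κ] [∀ k, Finite (L k)] [Finite ι]
    {φ : ∀ k, A →* L k} (hφ : ∀ k, Function.Injective (φ k))
    {w : ∀ k, L k → ι → ι → ℕ} (hw : ∀ k, IsInvMetric ⊤ Set.univ (w k))
    (hwA : ∀ k l a i j, w k (φ k a) i j = w l (φ l a) i j) :
    ∃ (D : Type) (_ : Group D) (_ : Finite D) (χ : ∀ k, L k →* D) (v : D → ι → ι → ℕ),
      (∀ k l a, χ k (φ k a) = χ l (φ l a)) ∧ IsInvMetric ⊤ Set.univ v ∧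
      ∀ k g i j, v (χ k g) i j = w k g i j := by
  classical
  obtain ⟨R, hR⟩ : ∃ R, ∀ k g i j, w k g i j < R + 1 := by
    obtain ⟨R, hR⟩ := (Set.finite_range
      (fun x : (Σ k, L k) × ι × ι => w x.1.1 x.1.2 x.2.1 x.2.2)).bddAbove
    exact ⟨R, fun k g i j => Nat.lt_succ_of_le (hR ⟨(⟨k, g⟩, i, j), rfl⟩)⟩
  let ψ : ∀ k, L k →* Monoid.PushoutI φ := fun k => Monoid.PushoutI.of k
  have hψ : ∀ k, Function.Injective (ψ k) := fun k => Monoid.PushoutI.of_injective hφ k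
  have hA : ∀ k l a, ψ k (φ k a) = ψ l (φ l a) := fun k l a => by
    simp only [ψ, Monoid.PushoutI.of_apply_eq_base]
  obtain ⟨Ω, _, χ, e, S, hS, h1S, hχA, hinj, he⟩ := exists_finite_perm_of_amalgam hφ hψ hA R
  -- Cheap paths lift to the amalgam. Letters of cost 0 are trivial and all others cost at least 1,
  -- so a path of cost `n` stays in `S ^ n`, where the permutations act as left multiplication.
  have hlow : ∀ {c x i n}, WPath χ w c x i n → n < R + 1 →
      ∃ γ ∈ S ^ n, WPath ψ w c γ i n ∧ x (e 1) = e γ := by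
    intro c x i n h
    induction h with
    | nil => exact fun _ => ⟨1, by simp, .nil, rfl⟩
    | @cons x j n k g i h ih =>
      intro hn
      obtain ⟨γ, hγ, hpath, hx⟩ := ih (by omega)
      refine ⟨ψ k g * γ, ?_, hpath.cons k g i, ?_⟩
      · rcases Nat.eq_zero_or_pos (w k g i j) with h0 | h0
        · obtain ⟨rfl, rfl⟩ := ((hw k).eq_zero_iff g trivial i trivial j trivial).1 h0
          simpa [h0] using hγ
        · refine Set.pow_subset_pow_right h1S (m := n + 1) (by omega) ?_
          rw [pow_succ']
          exact Set.mul_mem_mul (hS k g) hγ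
      · rw [Perm.mul_apply, hx, he n (by omega) k g γ hγ]
  -- The path metric is truncated at `R + 1`: this keeps it finite where no path exists and exceeds
  -- every prescribed distance.
  let P : Perm Ω → ι → ι → ℕ → Prop := fun x i c n => WPath χ w c x i n ∨ R + 1 ≤ n
  have hP : ∀ x i c, ∃ n, P x i c n := fun x i c => ⟨R + 1, Or.inr le_rfl⟩
  let v : Perm Ω → ι → ι → ℕ := fun x i c => Nat.find (hP x i c)
  have hv : ∀ x i c, P x i c (v x i c) := fun x i c => Nat.find_spec (hP x i c)
  have hvle : ∀ {x i c n}, P x i c n → v x i c ≤ n := fun h => Nat.find_min' _ h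
  refine ⟨Perm Ω, inferInstance, inferInstance, χ, v, hχA, ⟨?_, ?_, ?_⟩, ?_⟩
  · rintro x - i - j -
    constructor
    · intro h
      have h1 := hv x i j
      rw [h] at h1
      rcases h1 with h1 | h1
      · exact h1.eq_of_zero hw rfl
      · omega
    · rintro ⟨rfl, rfl⟩
      exact Nat.le_zero.1 (hvle (Or.inl .nil))
  · have h1 : ∀ x i j, v x⁻¹ j i ≤ v x i j := fun x i j => by
      rcases hv x i j with h | h
      · exact hvle (Or.inl (h.reverse hw))
      · exact hvle (Or.inr h)
    intro x _ i _ j _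
    refine le_antisymm (h1 x i j) ?_
    simpa using h1 x⁻¹ j i
  · intro x _ y _ i _ j _ k _
    rcases hv x i j with h | h
    · rcases hv y j k with h' | h'
      · exact hvle (Or.inl (h.append h'))
      · exact hvle (Or.inr (by omega))
    · exact hvle (Or.inr (by omega))
  · intro k g i j
    refine le_antisymm (hvle (Or.inl (.single k g i j))) ?_
    -- For the lower bound, a path of cost at most `R` lifts to the amalgam and ends at `ψ k g` by
    -- injectivity of `e`. Reduced with last letter in `L k`, it is a single letter.
    rcases lt_or_ge (v (χ k g) i j) (R + 1) with hlt | hge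
    · rcases hv (χ k g) i j with h | h
      · obtain ⟨γ, hγ, hpath, hx⟩ := hlow h hlt
        have hγg : γ = ψ k g := by
          refine hinj (Set.pow_subset_pow_right h1S (by omega) hγ)
            (Set.pow_subset_pow_right h1S (m := 1) (by omega) (by simpa using hS k g)) ?_
          have := he 0 (by omega) k g 1 (by simp)
          rw [← hx, this, mul_one]
        obtain ⟨k', n', hn', hred⟩ := hpath.exists_reduced hA hw hwA k
        exact (hred.le_of_eq_of hφ g hγg).trans hn'
      · omega
    · have := hR k g i j
      omega

/-! ### Katětov functions and the adjunction of a free orbit -/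

/-- The distance between two points of `G × ι` in the invariant metric given by `w`. -/
def invDist {G ι R : Type*} [Group G] (w : G → ι → ι → R) (x y : G × ι) : R :=
  w (x.1⁻¹ * y.1) x.2 y.2

theorem invDist_smul {G ι R : Type*} [Group G] (w : G → ι → ι → R) (g : G) (x y : G × ι) :
    invDist w (g * x.1, x.2) (g * y.1, y.2) = invDist w x y := by
  simp [invDist, mul_assoc]

namespace IsInvMetric

variable {G ι : Type*} [Group G] {K : Subgroup G} {I : Set ι}

theorem mono {R : Type*} [AddCommMonoid R] [PartialOrder R] {w : G → ι → ι → R}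
    (hw : IsInvMetric K I w) {K' : Subgroup G} {I' : Set ι} (hK : K' ≤ K) (hI : I' ⊆ I) :
    IsInvMetric K' I' w where
  eq_zero_iff g hg i hi j hj := hw.eq_zero_iff g (hK hg) i (hI hi) j (hI hj)
  symm g hg i hi j hj := hw.symm g (hK hg) i (hI hi) j (hI hj)
  triangle g hg h hh i hi j hj k hk :=
    hw.triangle g (hK hg) h (hK hh) i (hI hi) j (hI hj) k (hI hk)

theorem congr {R : Type*} [AddCommMonoid R] [PartialOrder R] {w v : G → ι → ι → R}
    (hw : IsInvMetric K I w) (h : ∀ g ∈ K, ∀ i ∈ I, ∀ j ∈ I, v g i j = w g i j) :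
    IsInvMetric K I v where
  eq_zero_iff g hg i hi j hj := by rw [h g hg i hi j hj, hw.eq_zero_iff g hg i hi j hj]
  symm g hg i hi j hj := by
    rw [h g hg i hi j hj, h _ (inv_mem hg) j hj i hi, hw.symm g hg i hi j hj]
  triangle g hg f hf i hi j hj k hk := by
    rw [h _ (mul_mem hg hf) i hi k hk, h g hg i hi j hj, h f hf j hj k hk]
    exact hw.triangle g hg f hf i hi j hj k hk

variable {w : G → ι → ι → ℚ}

theorem nonneg (hw : IsInvMetric K I w) {g : G} (hg : g ∈ K) {i j : ι} (hi : i ∈ I) (hj : j ∈ I) :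
    0 ≤ w g i j := by
  have h := hw.triangle g hg g⁻¹ (inv_mem hg) i hi j hj i hi
  rw [hw.symm g hg i hi j hj, mul_inv_cancel,
    (hw.eq_zero_iff 1 (one_mem _) i hi i hi).2 ⟨rfl, rfl⟩] at h
  linarith

theorem pos (hw : IsInvMetric K I w) {g : G} (hg : g ∈ K) {i j : ι} (hi : i ∈ I) (hj : j ∈ I)
    (h : ¬ (g = 1 ∧ i = j)) : 0 < w g i j :=
  lt_of_le_of_ne (hw.nonneg hg hi hj) fun h0 => h ((hw.eq_zero_iff g hg i hi j hj).1 h0.symm)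

theorem dist_self (hw : IsInvMetric K I w) {x : G × ι} (hx : x.2 ∈ I) :
    invDist w x x = 0 := by
  rw [invDist, inv_mul_cancel]
  exact (hw.eq_zero_iff 1 (one_mem _) _ hx _ hx).2 ⟨rfl, rfl⟩

theorem dist_comm (hw : IsInvMetric K I w) {x y : G × ι} (hx : x.1 ∈ K ∧ x.2 ∈ I)
    (hy : y.1 ∈ K ∧ y.2 ∈ I) : invDist w x y = invDist w y x := by
  have := hw.symm _ (mul_mem (inv_mem hx.1) hy.1) _ hx.2 _ hy.2
  rw [mul_inv_rev, inv_inv] at this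
  exact this.symm

theorem dist_triangle (hw : IsInvMetric K I w) {x y z : G × ι} (hx : x.1 ∈ K ∧ x.2 ∈ I)
    (hy : y.1 ∈ K ∧ y.2 ∈ I) (hz : z.1 ∈ K ∧ z.2 ∈ I) :
    invDist w x z ≤ invDist w x y + invDist w y z := by
  have := hw.triangle _ (mul_mem (inv_mem hx.1) hy.1) _ (mul_mem (inv_mem hy.1) hz.1)
    _ hx.2 _ hy.2 _ hz.2
  simpa [invDist, mul_assoc] using this

theorem dist_nonneg (hw : IsInvMetric K I w) {x y : G × ι} (hx : x.1 ∈ K ∧ x.2 ∈ I)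
    (hy : y.1 ∈ K ∧ y.2 ∈ I) : 0 ≤ invDist w x y :=
  hw.nonneg (mul_mem (inv_mem hx.1) hy.1) hx.2 hy.2

end IsInvMetric

/-- The distances `f` from a new point to the points of `W ⊆ G × ι` and the distances `s` from the
new point to its translates by elements of `A` are compatible with the invariant metric `w`. -/
structure IsKatetov {G ι : Type*} [Group G] (A : Subgroup G) (s : G → ℚ) (W : Set (G × ι))
    (w : G → ι → ι → ℚ) (f : G × ι → ℚ) : Prop where
  pos : ∀ x ∈ W, 0 < f x
  le_add : ∀ x ∈ W, ∀ y ∈ W, f x ≤ f y + invDist w y x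
  dist_le : ∀ x ∈ W, ∀ y ∈ W, invDist w x y ≤ f x + f y
  smul_mem : ∀ a ∈ A, ∀ x ∈ W, (a * x.1, x.2) ∈ W
  smul_le : ∀ a ∈ A, ∀ x ∈ W, f (a * x.1, x.2) ≤ s a + f x
  norm_le : ∀ a ∈ A, ∀ x ∈ W, s a ≤ f x + f (a * x.1, x.2)
  norm_eq_zero : ∀ a ∈ A, (s a = 0 ↔ a = 1)
  norm_inv : ∀ a ∈ A, s a⁻¹ = s a
  norm_mul : ∀ a ∈ A, ∀ b ∈ A, s (a * b) ≤ s a + s b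

namespace IsKatetov

variable {G ι : Type*} [Group G] {A : Subgroup G} {s : G → ℚ} {W : Set (G × ι)}
  {w : G → ι → ι → ℚ} {f : G × ι → ℚ}

theorem congr (h : IsKatetov A s W w f) {w' : G → ι → ι → ℚ} {s' : G → ℚ} {f' : G × ι → ℚ}
    (hw : ∀ x ∈ W, ∀ y ∈ W, invDist w' x y = invDist w x y) (hs : ∀ a ∈ A, s' a = s a)
    (hf : ∀ x ∈ W, f' x = f x) : IsKatetov A s' W w' f' where
  pos x hx := by rw [hf x hx]; exact h.pos x hx
  le_add x hx y hy := by rw [hf x hx, hf y hy, hw y hy x hx]; exact h.le_add x hx y hy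
  dist_le x hx y hy := by rw [hf x hx, hf y hy, hw x hx y hy]; exact h.dist_le x hx y hy
  smul_mem := h.smul_mem
  smul_le a ha x hx := by
    rw [hf _ (h.smul_mem a ha x hx), hf x hx, hs a ha]; exact h.smul_le a ha x hx
  norm_le a ha x hx := by
    rw [hf _ (h.smul_mem a ha x hx), hf x hx, hs a ha]; exact h.norm_le a ha x hx
  norm_eq_zero a ha := by rw [hs a ha]; exact h.norm_eq_zero a ha
  norm_inv a ha := by rw [hs a ha, hs _ (inv_mem ha)]; exact h.norm_inv a ha
  norm_mul a ha b hb := by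
    rw [hs a ha, hs b hb, hs _ (mul_mem ha hb)]; exact h.norm_mul a ha b hb

/-- Distances prescribed on a part of the space extend to the whole space. -/
theorem exists_extend (h : IsKatetov A s W w f) (hfin : W.Finite) (hne : W.Nonempty)
    {K : Subgroup G} {I : Set ι} (hw : IsInvMetric K I w) (hAK : A ≤ K)
    (hW : ∀ x ∈ W, x.1 ∈ K ∧ x.2 ∈ I) :
    ∃ f' : G × ι → ℚ, IsKatetov A s {x | x.1 ∈ K ∧ x.2 ∈ I} w f' ∧ ∀ x ∈ W, f' x = f x := by
  -- Katětov's formula: the largest admissible extension is the minimum over `y` in `W` of `f y +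
  -- invDist w y x`, attained at `p x`.
  have hmin : ∀ x, ∃ y ∈ W, ∀ z ∈ W, f y + invDist w y x ≤ f z + invDist w z x := fun x =>
    Set.exists_min_image W (fun y => f y + invDist w y x) hfin hne
  choose p hpW hp using hmin
  have hA : ∀ a ∈ A, ∀ x : G × ι, x.1 ∈ K ∧ x.2 ∈ I → a * x.1 ∈ K ∧ x.2 ∈ I :=
    fun a ha x hx => ⟨mul_mem (hAK ha) hx.1, hx.2⟩
  have hself : ∀ x ∈ W, f (p x) + invDist w (p x) x = f x := fun x hx => by
    refine le_antisymm ?_ (h.le_add x hx _ (hpW x))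
    simpa [hw.dist_self (hW x hx).2] using hp x x hx
  refine ⟨fun x => f (p x) + invDist w (p x) x, ⟨?_, ?_, ?_, hA, ?_, ?_, h.norm_eq_zero,
    h.norm_inv, h.norm_mul⟩, hself⟩
  · intro x hx
    exact add_pos_of_pos_of_nonneg (h.pos _ (hpW x)) (hw.dist_nonneg (hW _ (hpW x)) hx)
  · intro x hx y hy
    have h1 := hp x _ (hpW y)
    have h2 := hw.dist_triangle (hW _ (hpW y)) hy hx
    linarith
  · intro x hx y hy
    have h1 := hw.dist_triangle hx (hW _ (hpW x)) hy
    have h2 := hw.dist_triangle (hW _ (hpW x)) (hW _ (hpW y)) hy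
    have h3 := h.dist_le _ (hpW x) _ (hpW y)
    have h4 := hw.dist_comm hx (hW _ (hpW x))
    linarith
  · intro a ha x hx
    have h1 := hp (a * x.1, x.2) _ (h.smul_mem a ha _ (hpW x))
    rw [invDist_smul] at h1
    have h2 := h.smul_le a ha _ (hpW x)
    linarith
  · intro a ha x hx
    have h1 := h.norm_le a ha _ (hpW x)
    have h2 := h.le_add _ (h.smul_mem a ha _ (hpW x)) _ (hpW (a * x.1, x.2))
    have h3 := hw.dist_triangle (hW _ (hpW (a * x.1, x.2))) (y := (a * x.1, x.2)) (hA a ha x hx)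
      (hW _ (h.smul_mem a ha _ (hpW x)))
    rw [invDist_smul, hw.dist_comm hx (hW _ (hpW x))] at h3
    linarith

/-- The distances from a point of an invariant metric space are compatible with the metric. -/
theorem of_isInvMetric {J T : Set ι} (hw : IsInvMetric A J w) (hT : T ⊆ J) {c : ι} (hc : c ∈ J)
    (hcT : c ∉ T) :
    IsKatetov A (fun a => w a c c) {x | x.1 ∈ A ∧ x.2 ∈ T} w (fun x => w x.1 c x.2) := by
  have h1 : ∀ x : G × ι, w x.1 c x.2 = invDist w (1, c) x := fun x => by simp [invDist]
  have h1c : ((1, c) : G × ι).1 ∈ A ∧ ((1, c) : G × ι).2 ∈ J := ⟨one_mem _, hc⟩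
  have h2 : ∀ a : G, w a c c = invDist w (1, c) (a, c) := fun x => by simp [invDist]
  have h3 : ∀ (a : G) (x : G × ι), invDist w (a, c) (a * x.1, x.2) = invDist w (1, c) x :=
    fun a x => by simp [invDist]
  have hJ : ∀ x : G × ι, x.1 ∈ A ∧ x.2 ∈ T → x.1 ∈ A ∧ x.2 ∈ J := fun x hx => ⟨hx.1, hT hx.2⟩
  refine ⟨?_, ?_, ?_, ?_, ?_, ?_, ?_, ?_, ?_⟩
  · rintro x hx
    exact hw.pos hx.1 hc (hT hx.2) fun h => hcT (h.2 ▸ hx.2)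
  · rintro x hx y hy
    rw [h1, h1]
    exact hw.dist_triangle h1c (hJ y hy) (hJ x hx)
  · rintro x hx y hy
    rw [h1, h1, hw.dist_comm h1c (hJ x hx)]
    exact hw.dist_triangle (hJ x hx) h1c (hJ y hy)
  · exact fun a ha x hx => ⟨mul_mem ha hx.1, hx.2⟩
  · rintro a ha x hx
    simp only
    rw [h1 x, h2, h1 (a * x.1, x.2), ← h3 a x]
    exact hw.dist_triangle h1c ⟨ha, hc⟩ ⟨mul_mem ha hx.1, hT hx.2⟩
  · rintro a ha x hx
    simp only
    have hax : ((a * x.1, x.2) : G × ι).1 ∈ A ∧ ((a * x.1, x.2) : G × ι).2 ∈ J :=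
      ⟨mul_mem ha hx.1, hT hx.2⟩
    rw [h1 x, h2, h1 (a * x.1, x.2), ← h3 a x, hw.dist_comm (x := (a, c)) ⟨ha, hc⟩ hax, add_comm]
    exact hw.dist_triangle h1c hax ⟨ha, hc⟩
  · intro a ha
    simpa using hw.eq_zero_iff a ha c hc c hc
  · exact fun a ha => hw.symm a ha c hc c hc
  · exact fun a ha b hb => hw.triangle a ha b hb c hc c hc c hc

/-- Adding one free orbit to a finite invariant metric space. -/
theorem exists_insert_of_forall {K : Subgroup G} [Finite K] {I : Set ι} (hI : I.Finite)
    (hne : I.Nonempty) (h : IsKatetov A s {x | x.1 ∈ K ∧ x.2 ∈ I} w f) (hw : IsInvMetric K I w)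
    {n : ι} (hn : n ∉ I) :
    ∃ w' : G → ι → ι → ℚ, IsInvMetric K (insert n I) w' ∧
      (∀ g, ∀ i ∈ I, ∀ j ∈ I, w' g i j = w g i j) ∧ (∀ a ∈ A, w' a n n = s a) ∧
      ∀ g, ∀ i ∈ I, w' g n i = f (g, i) := by
  classical
  set P : Set (G × ι) := {x | x.1 ∈ K ∧ x.2 ∈ I} with hP
  have hPfin : P.Finite := (Set.toFinite (K : Set G)).prod hI
  have hPne : P.Nonempty := by
    obtain ⟨i, hi⟩ := hne
    exact ⟨(1, i), one_mem _, hi⟩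
  have hmin : ∀ g, ∃ x ∈ P, ∀ y ∈ P, f x + f (g⁻¹ * x.1, x.2) ≤ f y + f (g⁻¹ * y.1, y.2) := fun g =>
    Set.exists_min_image P (fun y => f y + f (g⁻¹ * y.1, y.2)) hPfin hPne
  choose p hpP hp using hmin
  have hKP : ∀ g ∈ K, ∀ x ∈ P, (g * x.1, x.2) ∈ P := fun g hg x hx => ⟨mul_mem hg hx.1, hx.2⟩
  -- `u g` is to be the distance from the new point to its translate by `g`. On `A` it is
  -- prescribed; elsewhere it is the largest value compatible with the triangle inequality through
  -- an old point, and `p g` is an optimal such point.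
  let u : G → ℚ := fun g => if g ∈ A then s g else f (p g) + f (g⁻¹ * (p g).1, (p g).2)
  have huA : ∀ g ∈ A, u g = s g := fun g hg => by simp [u, hg]
  have huN : ∀ g, g ∉ A → u g = f (p g) + f (g⁻¹ * (p g).1, (p g).2) := fun g hg => by simp [u, hg]
  have u1 : ∀ g ∈ K, ∀ x ∈ P, u g ≤ f x + f (g⁻¹ * x.1, x.2) := by
    intro g hg x hx
    by_cases hgA : g ∈ A
    · rw [huA g hgA, add_comm]
      simpa using h.norm_le g hgA _ (hKP _ (inv_mem hg) x hx)
    · rw [huN g hgA]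
      exact hp g x hx
  have u2 : ∀ g ∈ K, ∀ x ∈ P, f (g * x.1, x.2) ≤ u g + f x := by
    intro g hg x hx
    by_cases hgA : g ∈ A
    · rw [huA g hgA]
      exact h.smul_le g hgA x hx
    · rw [huN g hgA]
      have h1 := h.le_add _ (hKP g hg x hx) _ (hpP g)
      have h2 := h.dist_le _ (hKP _ (inv_mem hg) _ (hpP g)) x hx
      rw [← invDist_smul w g] at h2
      simp only [mul_inv_cancel_left] at h2
      linarith
  have u3 : ∀ g ∈ K, (u g = 0 ↔ g = 1) := by
    intro g hg
    by_cases hgA : g ∈ A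
    · rw [huA g hgA]
      exact h.norm_eq_zero g hgA
    · rw [huN g hgA]
      have h1 := h.pos _ (hpP g)
      have h2 := h.pos _ (hKP _ (inv_mem hg) _ (hpP g))
      exact ⟨fun h0 => absurd h0 (by linarith), fun h1 => absurd (h1 ▸ one_mem A) hgA⟩
  have u4' : ∀ g ∈ K, u g⁻¹ ≤ u g := by
    intro g hg
    by_cases hgA : g ∈ A
    · rw [huA g hgA, huA _ (inv_mem hgA), h.norm_inv g hgA]
    · rw [huN g hgA, add_comm]
      simpa using u1 _ (inv_mem hg) _ (hKP _ (inv_mem hg) _ (hpP g))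
  have u4 : ∀ g ∈ K, u g⁻¹ = u g := fun g hg =>
    le_antisymm (u4' g hg) (by simpa using u4' g⁻¹ (inv_mem hg))
  -- If one factor lies outside `A`, its optimal old point, suitably translated, is an intermediate
  -- point for the product.
  have u5 : ∀ g ∈ K, ∀ k ∈ K, u (g * k) ≤ u g + u k := by
    intro g hg k hk
    by_cases hgA : g ∈ A
    · by_cases hkA : k ∈ A
      · rw [huA g hgA, huA k hkA, huA _ (mul_mem hgA hkA)]
        exact h.norm_mul g hgA k hkA
      · have h1 := u1 _ (mul_mem hg hk) _ (hKP g hg _ (hpP k))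
        have h2 := u2 g hg _ (hpP k)
        simp only [mul_inv_rev, mul_assoc, inv_mul_cancel_left] at h1
        rw [huN k hkA]
        linarith
    · have h1 := u1 _ (mul_mem hg hk) _ (hpP g)
      have h2 := u2 _ (inv_mem hk) _ (hKP _ (inv_mem hg) _ (hpP g))
      rw [u4 k hk] at h2
      simp only [mul_inv_rev, mul_assoc] at h1 h2
      rw [huN g hgA]
      linarith
  -- By invariance and symmetry, the distance from `(1, i)` to the translate `(g, n)` of the new
  -- point is the distance from the new point to `(g⁻¹, i)`.
  let w' : G → ι → ι → ℚ := fun g i j =>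
    if i = n then (if j = n then u g else f (g, j)) else if j = n then f (g⁻¹, i) else w g i j
  have hin : ∀ i ∈ I, i ≠ n := fun i hi h => hn (h ▸ hi)
  have hnn : ∀ g, w' g n n = u g := fun g => by simp [w']
  have hni : ∀ g, ∀ i ∈ I, w' g n i = f (g, i) := fun g i hi => by simp [w', hin i hi]
  have hnj : ∀ g, ∀ i ∈ I, w' g i n = f (g⁻¹, i) := fun g i hi => by simp [w', hin i hi]
  have hij : ∀ g, ∀ i ∈ I, ∀ j ∈ I, w' g i j = w g i j := fun g i hi j hj => by
    simp [w', hin i hi, hin j hj]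
  refine ⟨w', ⟨?_, ?_, ?_⟩, hij, fun a ha => (hnn a).trans (huA a ha), hni⟩
  · rintro g hg i (rfl | hi) j (rfl | hj)
    · rw [hnn]
      simpa using u3 g hg
    · rw [hni g j hj]
      exact ⟨fun h0 => absurd h0 (h.pos (g, j) ⟨hg, hj⟩).ne', fun h0 => absurd h0.2.symm (hin j hj)⟩
    · rw [hnj g i hi]
      exact ⟨fun h0 => absurd h0 (h.pos (g⁻¹, i) ⟨inv_mem hg, hi⟩).ne',
        fun h0 => absurd h0.2 (hin i hi)⟩
    · rw [hij g i hi j hj]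
      exact hw.eq_zero_iff g hg i hi j hj
  · rintro g hg i (rfl | hi) j (rfl | hj)
    · rw [hnn, hnn, u4 g hg]
    · rw [hni g j hj, hnj _ j hj, inv_inv]
    · rw [hnj g i hi, hni _ i hi]
    · rw [hij g i hi j hj, hij _ j hj i hi, hw.symm g hg i hi j hj]
  · rintro g hg k hk i (rfl | hi) j (rfl | hj) l (rfl | hl)
    · rw [hnn, hnn, hnn]
      exact u5 g hg k hk
    · rw [hnn, hni _ l hl, hni _ l hl]
      exact u2 g hg (k, l) ⟨hk, hl⟩
    · rw [hnn, hni _ j hj, hnj _ j hj]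
      have := u1 _ (mul_mem hg hk) (g, j) ⟨hg, hj⟩
      simpa using this
    · rw [hni _ l hl, hni _ j hj, hij _ j hj l hl]
      have := h.le_add (g * k, l) ⟨mul_mem hg hk, hl⟩ (g, j) ⟨hg, hj⟩
      simpa [invDist] using this
    · rw [hnj _ i hi, hnj _ i hi, hnn]
      have := u2 _ (inv_mem hk) (g⁻¹, i) ⟨inv_mem hg, hi⟩
      rw [u4 k hk] at this
      simp only [mul_inv_rev] at this ⊢
      linarith
    · rw [hnj _ i hi, hni _ l hl, hij _ i hi l hl]
      have := h.dist_le (g⁻¹, i) ⟨inv_mem hg, hi⟩ (k, l) ⟨hk, hl⟩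
      simpa [invDist] using this
    · rw [hnj _ i hi, hnj _ j hj, hij _ i hi j hj]
      have := h.le_add ((g * k)⁻¹, i) ⟨inv_mem (mul_mem hg hk), hi⟩ (k⁻¹, j) ⟨inv_mem hk, hj⟩
      have h2 := hw.symm g hg i hi j hj
      simp only [invDist, inv_inv, mul_inv_rev, mul_inv_cancel_left] at this ⊢
      linarith
    · rw [hij _ i hi l hl, hij _ i hi j hj, hij _ j hj l hl]
      exact hw.triangle g hg k hk i hi j hj l hl

/-- Adding one free orbit with partially prescribed distances to a finite invariant metric
space. -/
theorem exists_insert {K : Subgroup G} [Finite K] {I : Set ι} (hI : I.Finite)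
    (h : IsKatetov A s W w f) (hAK : A ≤ K) (hW : ∀ x ∈ W, x.1 ∈ K ∧ x.2 ∈ I) (hne : W.Nonempty)
    (hw : IsInvMetric K I w) {n : ι} (hn : n ∉ I) :
    ∃ w' : G → ι → ι → ℚ, IsInvMetric K (insert n I) w' ∧
      (∀ g, ∀ i ∈ I, ∀ j ∈ I, w' g i j = w g i j) ∧ (∀ a ∈ A, w' a n n = s a) ∧
      ∀ x ∈ W, w' x.1 n x.2 = f x := by
  have hWfin : W.Finite := ((Set.toFinite (K : Set G)).prod hI).subset hW
  obtain ⟨f', hf', hff'⟩ := h.exists_extend hWfin hne hw hAK hW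
  obtain ⟨w', h1, h2, h3, h4⟩ := hf'.exists_insert_of_forall hI (hne.image Prod.snd |>.mono (by
    rintro _ ⟨x, hx, rfl⟩
    exact (hW x hx).2)) hw hn
  exact ⟨w', h1, h2, h3, fun x hx => (h4 _ _ (hW x hx).2).trans (hff' x hx)⟩

end IsKatetov

/-! ### Rational amalgamation, also inside Hall's group -/

theorem exists_nat_scaling {X : Type*} [Finite X] (f : X → ℚ) (hf : ∀ x, 0 ≤ f x) :
    ∃ M : ℕ, 0 < M ∧ ∃ F : X → ℕ, ∀ x, (F x : ℚ) = M * f x := by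
  have := Fintype.ofFinite X
  refine ⟨∏ x, (f x).den, Finset.prod_pos fun x _ => (f x).den_pos, ?_⟩
  have h : ∀ x, ∃ n : ℕ, (n : ℚ) = ((∏ x, (f x).den : ℕ) : ℚ) * f x := by
    intro x
    obtain ⟨c, hc⟩ := Finset.dvd_prod_of_mem (fun x => (f x).den) (Finset.mem_univ x)
    refine ⟨c * (f x).num.toNat, ?_⟩
    have h1 : ((f x).num.toNat : ℚ) = (f x).num := by
      exact_mod_cast Int.toNat_of_nonneg (Rat.num_nonneg.2 (hf x))
    rw [hc, Nat.cast_mul, Nat.cast_mul, h1, ← Rat.den_mul_eq_num]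
    ring
  choose F hF using h
  exact ⟨F, hF⟩

/-- Amalgamation of invariant rational metrics over a common subgroup. -/
theorem exists_amalgam_rat {κ ι A : Type} {L : κ → Type} [∀ k, Group (L k)]
    [Group A] [Finite κ] [Nonempty κ] [∀ k, Finite (L k)] [Finite ι]
    {φ : ∀ k, A →* L k} (hφ : ∀ k, Function.Injective (φ k))
    {w : ∀ k, L k → ι → ι → ℚ} (hw : ∀ k, IsInvMetric ⊤ Set.univ (w k))
    (hwA : ∀ k l a i j, w k (φ k a) i j = w l (φ l a) i j) :
    ∃ (D : Type) (_ : Group D) (_ : Finite D) (χ : ∀ k, L k →* D) (v : D → ι → ι → ℚ),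
      (∀ k l a, χ k (φ k a) = χ l (φ l a)) ∧ IsInvMetric ⊤ Set.univ v ∧
      ∀ k g i j, v (χ k g) i j = w k g i j := by
  obtain ⟨M, hM, F, hF⟩ := exists_nat_scaling
    (fun x : (Σ k, L k) × ι × ι => w x.1.1 x.1.2 x.2.1 x.2.2)
    (fun x => (hw x.1.1).nonneg trivial trivial trivial)
  have hF' : ∀ k g i j, (F (⟨k, g⟩, i, j) : ℚ) = M * w k g i j := fun k g i j => hF (⟨k, g⟩, i, j)
  have hM' : (M : ℚ) ≠ 0 := by exact_mod_cast hM.ne'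
  have hM0 : (0 : ℚ) < M := by exact_mod_cast hM
  have hFm : ∀ k, IsInvMetric ⊤ Set.univ (fun (g : L k) i j => F (⟨k, g⟩, i, j)) := by
    refine fun k => ⟨?_, ?_, ?_⟩
    · intro g hg i hi j hj
      rw [← (hw k).eq_zero_iff g hg i hi j hj, ← Nat.cast_eq_zero (R := ℚ), hF']
      simp [hM']
    · intro g hg i hi j hj
      rw [← Nat.cast_inj (R := ℚ), hF', hF', (hw k).symm g hg i hi j hj]
    · intro g hg h hh i hi j hj l hl
      rw [← Nat.cast_le (α := ℚ), Nat.cast_add, hF', hF', hF', ← mul_add]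
      gcongr
      exact (hw k).triangle g hg h hh i hi j hj l hl
  have hFA : ∀ k l a i j, F (⟨k, φ k a⟩, i, j) = F (⟨l, φ l a⟩, i, j) := by
    intro k l a i j
    rw [← Nat.cast_inj (R := ℚ), hF', hF', hwA k l]
  obtain ⟨D, i1, i2, χ, v, h1, h2, h3⟩ := exists_amalgam_nat hφ hFm hFA
  refine ⟨D, i1, i2, χ, fun g i j => v g i j / M, h1, ⟨?_, ?_, ?_⟩, ?_⟩
  · intro g hg i hi j hj
    rw [div_eq_zero_iff, ← h2.eq_zero_iff g hg i hi j hj, Nat.cast_eq_zero]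
    simp [hM']
  · intro g hg i hi j hj
    simp only [h2.symm g hg i hi j hj]
  · intro g hg h hh i hi j hj k hk
    rw [← add_div]
    gcongr
    exact_mod_cast h2.triangle g hg h hh i hi j hj k hk
  · intro k g i j
    simp only [h3, hF']
    field_simp

section

variable {G : Type} [Group G]

/-- In Hall's group, finite subgroups with invariant metrics can be amalgamated. -/
theorem IsHallGroup.exists_amalgam (hG : IsHallGroup G) {ι : Type} {K B A : Subgroup G} [Finite K]
    [Finite B] (hK : A ≤ K) (hB : A ≤ B) {I : Set ι} (hI : I.Finite) (hne : I.Nonempty)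
    {w e : G → ι → ι → ℚ} (hw : IsInvMetric K I w) (he : IsInvMetric B I e)
    (hwe : ∀ a ∈ A, ∀ i ∈ I, ∀ j ∈ I, w a i j = e a i j) :
    ∃ (τ : B →* G) (K' : Subgroup G) (w' : G → ι → ι → ℚ), Finite K' ∧ K ≤ K' ∧
      IsInvMetric K' I w' ∧ (∀ g ∈ K, ∀ i ∈ I, ∀ j ∈ I, w' g i j = w g i j) ∧
      (∀ b : B, τ b ∈ K') ∧ (∀ b : B, (b : G) ∈ A → τ b = b) ∧
      ∀ b : B, ∀ i ∈ I, ∀ j ∈ I, w' (τ b) i j = e b i j := by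
  classical
  have : Finite I := hI.to_subtype
  let L : Bool → Subgroup G := fun b => bif b then K else B
  have hL : ∀ b, A ≤ L b := fun b => by cases b <;> assumption
  have hfin : ∀ b, Finite (L b) := fun b => by cases b <;> assumption
  let W : Bool → G → ι → ι → ℚ := fun b => bif b then w else e
  have hW : ∀ b, IsInvMetric (L b) I (W b) := fun b => by cases b <;> assumption
  obtain ⟨D, _, _, χ, v, hχ, hv, hvW⟩ := exists_amalgam_rat (κ := Bool) (ι := I)
    (L := fun b => L b) (φ := fun b => Subgroup.inclusion (hL b))
    (fun b => Subgroup.inclusion_injective _) (w := fun b g i j => W b g i j)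
    (fun b => ⟨fun g _ i _ j _ => by
        rw [(hW b).eq_zero_iff g g.2 i i.2 j j.2, ← Subtype.ext_iff, OneMemClass.coe_eq_one],
      fun g _ i _ j _ => (hW b).symm g g.2 i i.2 j j.2,
      fun g _ h _ i _ j _ k _ => (hW b).triangle g g.2 h h.2 i i.2 j j.2 k k.2⟩)
    (fun k l a i j => by
      have := hwe a a.2 i i.2 j j.2
      cases k <;> cases l <;> simp [W, this])
  obtain ⟨i₀, hi₀⟩ := hne
  -- Preserving the metric on one orbit forces injectivity, which is where an index `i₀` is needed.
  have hinj : Function.Injective (χ true) := by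
    rw [injective_iff_map_eq_one]
    intro g hg
    have h1 := hvW true g ⟨i₀, hi₀⟩ ⟨i₀, hi₀⟩
    rw [hg, (hv.eq_zero_iff 1 trivial _ trivial _ trivial).2 ⟨rfl, rfl⟩] at h1
    exact Subtype.ext (((hW true).eq_zero_iff g g.2 i₀ hi₀ i₀ hi₀).1 h1.symm).1
  -- The abstract amalgam is embedded in `G` over `K`, so `K` stays in place and only `B` moves,
  -- fixing `A`.
  obtain ⟨σ, hσ, hσχ⟩ := hG.extension (L true) D (χ true) (L true).subtype hinj
    (Subgroup.subtype_injective _)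
  have hσχ' : ∀ g : L true, σ (χ true g) = g := fun g => DFunLike.congr_fun hσχ g
  have hinv : ∀ x, Function.invFun σ (σ x) = x := Function.leftInverse_invFun hσ
  let w' : G → ι → ι → ℚ := fun g i j =>
    if h : i ∈ I ∧ j ∈ I then v (Function.invFun σ g) ⟨i, h.1⟩ ⟨j, h.2⟩ else 0
  have hw' : ∀ x i (hi : i ∈ I) j (hj : j ∈ I), w' (σ x) i j = v x ⟨i, hi⟩ ⟨j, hj⟩ :=
    fun x i hi j hj => by simp [w', hi, hj, hinv]
  refine ⟨σ.comp (χ false), σ.range, w', Set.finite_range σ, fun g hg => ⟨χ true ⟨g, hg⟩, hσχ' _⟩,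
    ⟨?_, ?_, ?_⟩, fun g hg i hi j hj => ?_, fun b => ⟨_, rfl⟩, fun b hb => ?_,
    fun b i hi j hj => ?_⟩
  · rintro _ ⟨x, rfl⟩ i hi j hj
    rw [hw' x i hi j hj, hv.eq_zero_iff x trivial _ trivial _ trivial, Subtype.mk.injEq,
      map_eq_one_iff σ hσ]
  · rintro _ ⟨x, rfl⟩ i hi j hj
    rw [← map_inv, hw' _ j hj i hi, hw' _ i hi j hj, hv.symm x trivial _ trivial _ trivial]
  · rintro _ ⟨x, rfl⟩ _ ⟨y, rfl⟩ i hi j hj k hk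
    rw [← map_mul, hw' _ i hi k hk, hw' _ i hi j hj, hw' _ j hj k hk]
    exact hv.triangle x trivial y trivial _ trivial _ trivial _ trivial
  · have := hw' (χ true ⟨g, hg⟩) i hi j hj
    rw [hσχ', hvW true] at this
    exact this
  · have := hχ false true ⟨b, hb⟩
    have h2 := hσχ' (Subgroup.inclusion (hL true) ⟨b, hb⟩)
    rw [← this] at h2
    exact h2
  · change w' (σ (χ false b)) i j = _
    rw [hw' _ i hi j hj, hvW false]
    rfl

/-- An invariant metric on `B × T` and an invariant metric on `A × I`, where `A ≤ B` and `T ⊆ I`,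
can be amalgamated. -/
theorem IsInvMetric.exists_extend_index {ι : Type*} {A B : Subgroup G} [Finite B] (hAB : A ≤ B)
    {I T : Set ι} (hI : I.Finite) (hT : T.Nonempty) (hTI : T ⊆ I) {w e : G → ι → ι → ℚ}
    (hw : IsInvMetric A I w) (he : IsInvMetric B T e)
    (hwe : ∀ a ∈ A, ∀ i ∈ T, ∀ j ∈ T, e a i j = w a i j) :
    ∃ e' : G → ι → ι → ℚ, IsInvMetric B I e' ∧ (∀ g, ∀ i ∈ T, ∀ j ∈ T, e' g i j = e g i j) ∧
      ∀ a ∈ A, ∀ i ∈ I, ∀ j ∈ I, e' a i j = w a i j := by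
  -- The missing indices are added one at a time. The old metric on `A` and the new index is a
  -- Katětov datum over the orbits already present, so a free `B`-orbit realizing it can be
  -- adjoined.
  have key : ∀ S : Set ι, S.Finite → S ⊆ I → ∃ e' : G → ι → ι → ℚ, IsInvMetric B (S ∪ T) e' ∧
      (∀ g, ∀ i ∈ T, ∀ j ∈ T, e' g i j = e g i j) ∧
      ∀ a ∈ A, ∀ i ∈ S ∪ T, ∀ j ∈ S ∪ T, e' a i j = w a i j := by
    intro S hS
    induction S, hS using Set.Finite.induction_on with
    | empty => exact fun _ => ⟨e, by simpa using he, fun _ _ _ _ _ => rfl, by simpa using hwe⟩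
    | @insert c S hcS hS ih =>
      intro hSI
      obtain ⟨e', h1, h2, h3⟩ := ih ((Set.subset_insert c S).trans hSI)
      rw [Set.insert_union]
      by_cases hcT : c ∈ S ∪ T
      · rw [Set.insert_eq_of_mem hcT]
        exact ⟨e', h1, h2, h3⟩
      have hcI : c ∈ I := hSI (Set.mem_insert c S)
      have hSTI : S ∪ T ⊆ I := Set.union_subset ((Set.subset_insert c S).trans hSI) hTI
      have hk := (IsKatetov.of_isInvMetric hw hSTI hcI hcT).congr (w' := e')
        (fun x hx y hy => h3 _ (mul_mem (inv_mem hx.1) hy.1) _ hx.2 _ hy.2)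
        (fun _ _ => rfl) (fun _ _ => rfl)
      obtain ⟨e'', k1, k2, k3, k4⟩ := hk.exists_insert (hI.subset hSTI) hAB
        (fun x hx => ⟨hAB hx.1, hx.2⟩)
        (hT.elim fun t ht => ⟨(1, t), one_mem _, Or.inr ht⟩) h1 hcT
      refine ⟨e'', k1, fun g i hi j hj => ?_, ?_⟩
      · rw [k2 g i (Or.inr hi) j (Or.inr hj), h2 g i hi j hj]
      · have k4' : ∀ a ∈ A, ∀ j ∈ S ∪ T, e'' a c j = w a c j := fun a ha j hj => k4 (a, j) ⟨ha, hj⟩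
        rintro a ha i (rfl | hi) j (rfl | hj)
        · exact k3 a ha
        · exact k4' a ha j hj
        · rw [← k1.symm _ (hAB ha) _ (Or.inr hi) _ (Or.inl rfl), k4' _ (inv_mem ha) i hi,
            hw.symm a ha _ (hSTI hi) _ hcI]
        · rw [k2 a i hi j hj, h3 a ha i hi j hj]
  obtain ⟨e', h1, h2, h3⟩ := key I hI le_rfl
  rw [Set.union_eq_self_of_subset_right hTI] at h1 h3
  exact ⟨e', h1, h2, h3⟩

end

/-! ### The generic invariant metric on G × ℕ -/

/-- Finite approximations to an invariant rational metric on `G × ℕ`. -/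
structure FinInvMetric (G : Type*) [Group G] where
  /-- the finite subgroup -/
  K : Subgroup G
  /-- the number of orbits -/
  k : ℕ
  /-- the metric -/
  w : G → ℕ → ℕ → ℚ
  finite : Finite K
  pos : 0 < k
  isInvMetric : IsInvMetric K (Set.Iio k) w

namespace FinInvMetric

variable {G : Type} [Group G]

instance : Preorder (FinInvMetric G) where
  le p q := p.K ≤ q.K ∧ p.k ≤ q.k ∧ ∀ g ∈ p.K, ∀ i < p.k, ∀ j < p.k, q.w g i j = p.w g i j
  le_refl p := ⟨le_rfl, le_rfl, fun _ _ _ _ _ _ => rfl⟩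
  le_trans p q r h h' := ⟨h.1.trans h'.1, h.2.1.trans h'.2.1, fun g hg i hi j hj => by
    rw [h'.2.2 g (h.1 hg) i (hi.trans_le h.2.1) j (hj.trans_le h.2.1), h.2.2 g hg i hi j hj]⟩

theorem exists_bound (p : FinInvMetric G) :
    ∃ R : ℚ, 0 < R ∧ ∀ g ∈ p.K, ∀ i < p.k, ∀ j < p.k, p.w g i j ≤ R := by
  have := p.finite
  obtain ⟨R, hR⟩ := (((Set.toFinite (p.K : Set G)).prod ((Set.finite_Iio p.k).prod
    (Set.finite_Iio p.k))).image fun x => p.w x.1 x.2.1 x.2.2).bddAbove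
  refine ⟨max R 1, lt_max_of_lt_right one_pos, fun g hg i hi j hj => le_max_of_le_left ?_⟩
  exact hR ⟨(g, i, j), ⟨hg, hi, hj⟩, rfl⟩

/-- Different cosets of `p.K` are put at the constant distance `R`, a bound for all distances in
`p`; a triangle leaving the coset then has a side `R` on the right of its inequality. -/
theorem exists_le_group (p : FinInvMetric G) (K' : Subgroup G) [Finite K'] (h : p.K ≤ K') :
    ∃ q, p ≤ q ∧ q.K = K' ∧ q.k = p.k := by
  classical
  obtain ⟨R, hR, hle⟩ := p.exists_bound
  let v : G → ℕ → ℕ → ℚ := fun g i j => if g ∈ p.K then p.w g i j else R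
  have hv : ∀ g ∈ p.K, ∀ i j, v g i j = p.w g i j := fun g hg i j => by simp [v, hg]
  have hv' : ∀ g, g ∉ p.K → ∀ i j, v g i j = R := fun g hg i j => by simp [v, hg]
  have h0 : ∀ g i j, i < p.k → j < p.k → 0 ≤ v g i j := fun g i j hi hj => by
    by_cases hg : g ∈ p.K
    · rw [hv g hg]
      exact p.isInvMetric.nonneg hg hi hj
    · rw [hv' g hg]
      exact hR.le
  refine ⟨⟨K', p.k, v, ‹_›, p.pos, ⟨?_, ?_, ?_⟩⟩,
    ⟨h, le_rfl, fun g hg i hi j hj => hv g hg i j⟩, rfl, rfl⟩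
  · intro g _ i hi j hj
    by_cases hg : g ∈ p.K
    · rw [hv g hg]
      exact p.isInvMetric.eq_zero_iff g hg i hi j hj
    · rw [hv' g hg]
      exact ⟨fun h => absurd h hR.ne', fun h => absurd (h.1 ▸ one_mem p.K) hg⟩
  · intro g _ i hi j hj
    by_cases hg : g ∈ p.K
    · rw [hv g hg, hv _ (inv_mem hg)]
      exact p.isInvMetric.symm g hg i hi j hj
    · rw [hv' g hg, hv' _ (by simpa using hg)]
  · intro g _ f _ i hi j hj l hl
    by_cases hg : g ∈ p.K
    · by_cases hf : f ∈ p.K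
      · rw [hv g hg, hv f hf, hv _ (mul_mem hg hf)]
        exact p.isInvMetric.triangle g hg f hf i hi j hj l hl
      · rw [hv' f hf, hv' (g * f) (by rwa [mul_mem_cancel_left hg])]
        linarith [h0 g i j hi hj]
    · have h1 : v (g * f) i l ≤ R := by
        by_cases hgf : g * f ∈ p.K
        · rw [hv _ hgf]
          exact hle _ hgf i hi l hl
        · rw [hv' _ hgf]
      rw [hv' g hg]
      linarith [h0 f j l hj hl]

theorem exists_insert (p : FinInvMetric G) {A : Subgroup G} {s : G → ℚ} {W : Set (G × ℕ)}
    {f : G × ℕ → ℚ} (h : IsKatetov A s W p.w f) (hA : A ≤ p.K)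
    (hW : ∀ x ∈ W, x.1 ∈ p.K ∧ x.2 < p.k) (hne : W.Nonempty) :
    ∃ q, p ≤ q ∧ p.k < q.k ∧ (∀ a ∈ A, q.w a p.k p.k = s a) ∧
      ∀ x ∈ W, q.w x.1 p.k x.2 = f x := by
  have := p.finite
  obtain ⟨w', h1, h2, h3, h4⟩ := h.exists_insert (Set.finite_Iio p.k) hA hW hne p.isInvMetric
    (n := p.k) (by simp)
  refine ⟨⟨p.K, p.k + 1, w', p.finite, by simp, h1.mono le_rfl ?_⟩,
    ⟨le_rfl, Nat.le_succ _, fun g hg i hi j hj => h2 g i hi j hj⟩, Nat.lt_succ_self _, h3, h4⟩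
  intro i hi
  rw [Set.mem_Iio, Nat.lt_succ_iff_lt_or_eq] at hi
  exact hi.symm

theorem exists_lt_k (p : FinInvMetric G) (n : ℕ) : ∃ q, p ≤ q ∧ n < q.k := by
  induction n with
  | zero => exact ⟨p, le_rfl, p.pos⟩
  | succ n ih =>
    obtain ⟨q, hpq, hq⟩ := ih
    obtain ⟨R, hR, hle⟩ := q.exists_bound
    -- A new orbit can always be placed at a constant distance that bounds all existing ones.
    have hk : IsKatetov (⊥ : Subgroup G) 0 {x : G × ℕ | x.1 ∈ q.K ∧ x.2 < q.k} q.w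
        fun _ => R := by
      refine ⟨fun _ _ => hR, fun x hx y hy => ?_, fun x hx y hy => ?_, ?_, ?_, ?_, ?_, ?_, ?_⟩
      · linarith [q.isInvMetric.dist_nonneg hy hx]
      · have := hle _ (mul_mem (inv_mem hx.1) hy.1) _ hx.2 _ hy.2
        rw [invDist]
        linarith
      · rintro a ha x hx
        rw [Subgroup.mem_bot.1 ha]
        simpa using hx
      all_goals simp
      · intros
        exact hR.le
    obtain ⟨r, hqr, hr, -⟩ := q.exists_insert hk bot_le (fun x hx => hx) ⟨(1, 0), one_mem _, q.pos⟩
    exact ⟨r, hpq.trans hqr, by omega⟩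

theorem exists_le_of_locallyFinite (hG : IsLocallyFiniteGroup G) (p : FinInvMetric G)
    (A : Subgroup G) (hA : A.FG) (n : ℕ) : ∃ q, p ≤ q ∧ A ≤ q.K ∧ n < q.k := by
  have := p.finite
  have h1 : Finite (p.K ⊔ A : Subgroup G) :=
    hG _ ((Group.fg_iff_subgroup_fg _).1 inferInstance |>.sup hA)
  obtain ⟨q, hpq, hq, -⟩ := p.exists_le_group (p.K ⊔ A) le_sup_left
  obtain ⟨r, hqr, hr⟩ := q.exists_lt_k n
  exact ⟨r, hpq.trans hqr, (le_sup_right.trans hq.ge).trans hqr.1, hr⟩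

/-- The requirements met by a generic invariant metric. -/
def coveringSet (x : G × ℕ) : Set (FinInvMetric G) := {p | x.1 ∈ p.K ∧ x.2 < p.k}

/-- The requirements met by a generic invariant metric: new orbits. -/
def orbitSet (x : Finset G × (G →₀ ℚ) × Finset (G × ℕ) × (G × ℕ →₀ ℚ)) : Set (FinInvMetric G) :=
  {p | Subgroup.closure x.1 ≤ p.K ∧ (∀ y ∈ x.2.2.1, y.1 ∈ p.K ∧ y.2 < p.k) ∧
    (x.2.2.1.Nonempty → IsKatetov (Subgroup.closure (x.1 : Set G)) x.2.1 x.2.2.1 p.w x.2.2.2 →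
      ∃ n < p.k, (∀ a ∈ Subgroup.closure (x.1 : Set G), p.w a n n = x.2.1 a) ∧
        ∀ y ∈ x.2.2.1, p.w y.1 n y.2 = x.2.2.2 y)}

/-- The requirements met by a generic invariant metric: larger groups. -/
def groupSet (x : Finset G × Finset G × Finset ℕ × (G × ℕ × ℕ →₀ ℚ)) : Set (FinInvMetric G) :=
  {p | Subgroup.closure x.1 ≤ p.K ∧ (∀ i ∈ x.2.2.1, i < p.k) ∧
    (x.2.2.1.Nonempty → Subgroup.closure (x.1 : Set G) ≤ Subgroup.closure (x.2.1 : Set G) →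
      IsInvMetric (Subgroup.closure (x.2.1 : Set G)) x.2.2.1 (fun g i j => x.2.2.2 (g, i, j)) →
      (∀ a ∈ Subgroup.closure (x.1 : Set G), ∀ i ∈ x.2.2.1, ∀ j ∈ x.2.2.1,
        p.w a i j = x.2.2.2 (a, i, j)) →
      ∃ τ : Subgroup.closure (x.2.1 : Set G) →* G,
        (∀ b : Subgroup.closure (x.2.1 : Set G),
          (b : G) ∈ Subgroup.closure (x.1 : Set G) → τ b = b) ∧
        ∀ b : Subgroup.closure (x.2.1 : Set G), τ b ∈ p.K ∧ ∀ i ∈ x.2.2.1, ∀ j ∈ x.2.2.1, p.w (τ b) i j = x.2.2.2 (b, i, j))}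

theorem isCofinal_coveringSet (hG : IsHallGroup G) (x : G × ℕ) : IsCofinal (coveringSet x) := by
  intro p
  obtain ⟨q, hpq, hq, hk⟩ := p.exists_le_of_locallyFinite hG.locallyFinite
    (Subgroup.closure {x.1}) ⟨{x.1}, by simp⟩ x.2
  exact ⟨q, ⟨hq (Subgroup.subset_closure rfl), hk⟩, hpq⟩

/-- Once `W` and the generators are covered, the metric on `W` is decided. Either the Katětov
condition fails and the requirement is vacuous, or the orbit can be adjoined. -/
theorem isCofinal_orbitSet (hG : IsHallGroup G)
    (x : Finset G × (G →₀ ℚ) × Finset (G × ℕ) × (G × ℕ →₀ ℚ)) : IsCofinal (orbitSet x) := by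
  classical
  obtain ⟨S, s, W, f⟩ := x
  intro p
  obtain ⟨q, hpq, hq, hk⟩ := p.exists_le_of_locallyFinite hG.locallyFinite
    (Subgroup.closure ((S ∪ W.image Prod.fst : Finset G) : Set G)) ⟨_, rfl⟩ (W.sup Prod.snd)
  have hS : Subgroup.closure (S : Set G) ≤ q.K := by
    refine (Subgroup.closure_mono ?_).trans hq
    simp
  have hW : ∀ y ∈ W, y.1 ∈ q.K ∧ y.2 < q.k := fun y hy =>
    ⟨hq (Subgroup.subset_closure (by
      rw [Finset.coe_union]
      exact Or.inr (Finset.mem_coe.2 (Finset.mem_image_of_mem Prod.fst hy)))),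
    (Finset.le_sup (f := Prod.snd) hy).trans_lt hk⟩
  by_cases h : W.Nonempty ∧ IsKatetov (Subgroup.closure (S : Set G)) s W q.w f
  · obtain ⟨r, hqr, hk', h1, h2⟩ := q.exists_insert h.2 hS hW h.1
    exact ⟨r, ⟨hS.trans hqr.1, fun y hy => ⟨hqr.1 (hW y hy).1, (hW y hy).2.trans_le hqr.2.1⟩,
      fun _ _ => ⟨q.k, hk', h1, h2⟩⟩, hpq.trans hqr⟩
  · exact ⟨q, ⟨hS, hW, fun h1 h2 => absurd ⟨h1, h2⟩ h⟩, hpq⟩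

/-- If the data are consistent, the prescribed metric on `B` is first extended to all orbits
present, and then amalgamated over `A` with the approximation inside `G`. -/
theorem isCofinal_groupSet (hG : IsHallGroup G)
    (x : Finset G × Finset G × Finset ℕ × (G × ℕ × ℕ →₀ ℚ)) : IsCofinal (groupSet x) := by
  classical
  obtain ⟨S, T, I, e⟩ := x
  intro p
  obtain ⟨q, hpq, hS, hk⟩ := p.exists_le_of_locallyFinite hG.locallyFinite
    (Subgroup.closure (S : Set G)) ⟨_, rfl⟩ (I.sup id)
  have hI : ∀ i ∈ I, i < q.k := fun i hi => (Finset.le_sup (f := id) hi).trans_lt hk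
  by_cases h : I.Nonempty ∧ Subgroup.closure (S : Set G) ≤ Subgroup.closure (T : Set G) ∧
      IsInvMetric (Subgroup.closure (T : Set G)) I (fun g i j => e (g, i, j)) ∧
      (∀ a ∈ Subgroup.closure (S : Set G), ∀ i ∈ I, ∀ j ∈ I, q.w a i j = e (a, i, j))
  · obtain ⟨hne, hST, he, hwe⟩ := h
    have := q.finite
    have hTfin : Finite (Subgroup.closure (T : Set G)) := hG.locallyFinite _ ⟨_, rfl⟩
    obtain ⟨e', he', h1, h2⟩ := IsInvMetric.exists_extend_index hST (Set.finite_Iio q.k)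
      (Finset.coe_nonempty.2 hne) hI (q.isInvMetric.mono hS le_rfl) he
      (fun a ha i hi j hj => (hwe a ha i hi j hj).symm)
    obtain ⟨τ, K', w', hK'fin, hK', hw', h3, h4, h5, h6⟩ := hG.exists_amalgam hS hST
      (Set.finite_Iio q.k) ⟨0, q.pos⟩ q.isInvMetric he'
      (fun a ha i hi j hj => (h2 a ha i hi j hj).symm)
    refine ⟨⟨K', q.k, w', hK'fin, q.pos, hw'⟩, ⟨hS.trans hK', hI, fun _ _ _ _ =>
      ⟨τ, h5, fun b => ⟨h4 b, fun i hi j hj => ?_⟩⟩⟩, hpq.trans ⟨hK', le_rfl, h3⟩⟩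
    exact (h6 b i (hI i hi) j (hI j hj)).trans (h1 b i hi j hj)
  · exact ⟨q, ⟨hS, hI, fun h1 h2 h3 h4 => absurd ⟨h1, h2, h3, h4⟩ h⟩, hpq⟩

end FinInvMetric

/-- An invariant rational metric on `G × ℕ` is generic if it has the extension properties of a
Fraïssé limit with respect to adding orbits and enlarging finite subgroups. -/
structure IsGenericInvMetric {G : Type} [Group G] (w : G → ℕ → ℕ → ℚ) : Prop where
  isInvMetric : IsInvMetric ⊤ Set.univ w
  exists_orbit : ∀ (A : Subgroup G) [Finite A] (s : G → ℚ) (W : Set (G × ℕ)) (f : G × ℕ → ℚ),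
    W.Finite → W.Nonempty → IsKatetov A s W w f →
      ∃ n, (∀ a ∈ A, w a n n = s a) ∧ ∀ x ∈ W, w x.1 n x.2 = f x
  exists_hom : ∀ (A B : Subgroup G) [Finite B] (I : Set ℕ) (e : G → ℕ → ℕ → ℚ),
    A ≤ B → I.Finite → I.Nonempty → IsInvMetric B I e →
      (∀ a ∈ A, ∀ i ∈ I, ∀ j ∈ I, w a i j = e a i j) →
      ∃ τ : B →* G, (∀ b : B, (b : G) ∈ A → τ b = b) ∧
        ∀ b : B, ∀ i ∈ I, ∀ j ∈ I, w (τ b) i j = e b i j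

theorem exists_finset_closure_eq {G : Type*} [Group G] (A : Subgroup G) [Finite A] :
    ∃ S : Finset G, Subgroup.closure (S : Set G) = A :=
  (Group.fg_iff_subgroup_fg A).1 inferInstance

theorem exists_finsupp_eqOn {X : Type*} {S : Set X} (hS : S.Finite) (f : X → ℚ) :
    ∃ F : X →₀ ℚ, ∀ x ∈ S, F x = f x := by
  classical
  refine ⟨Finsupp.onFinset hS.toFinset (S.indicator f) fun x hx => ?_, fun x hx => ?_⟩
  · rw [Set.Finite.mem_toFinset]
    exact Set.mem_of_indicator_ne_zero hx
  · simp [hx]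

-- A directed ideal of approximations meeting all requirements exists because there are only
-- countably many; its union is the generic metric.
open FinInvMetric in
theorem IsHallGroup.exists_isGenericInvMetric {G : Type} [Group G] (hG : IsHallGroup G) :
    ∃ w : G → ℕ → ℕ → ℚ, IsGenericInvMetric w := by
  classical
  have := hG.countable
  let T1 := G × ℕ
  -- Generators and finitely supported functions encode finite subgroups and finite data by
  -- countably many parameters.
  let T2 := Finset G × (G →₀ ℚ) × Finset (G × ℕ) × (G × ℕ →₀ ℚ)
  let T3 := Finset G × Finset G × Finset ℕ × (G × ℕ × ℕ →₀ ℚ)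
  let 𝒟 : T1 ⊕ T2 ⊕ T3 → Order.Cofinal (FinInvMetric G) := fun t => match t with
    | .inl x => ⟨coveringSet x, isCofinal_coveringSet hG x⟩
    | .inr (.inl x) => ⟨orbitSet x, isCofinal_orbitSet hG x⟩
    | .inr (.inr x) => ⟨groupSet x, isCofinal_groupSet hG x⟩
  let p₀ : FinInvMetric G := ⟨⊥, 1, 0, inferInstance, one_pos, by
    refine ⟨fun g hg i hi j hj => ?_, by simp, by simp⟩
    simp only [Subgroup.mem_bot, Set.mem_Iio, Nat.lt_one_iff] at hg hi hj
    simp [hg, hi, hj]⟩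
  have : Encodable (T1 ⊕ T2 ⊕ T3) := Encodable.ofCountable _
  let 𝓘 := Order.idealOfCofinals p₀ 𝒟
  have hmeet : ∀ t, ∃ p, p ∈ (𝒟 t).carrier ∧ p ∈ 𝓘 := fun t =>
    Order.cofinal_meets_idealOfCofinals p₀ 𝒟 t
  have hcov : ∀ x : G × ℕ × ℕ, ∃ p ∈ 𝓘, x.1 ∈ p.K ∧ x.2.1 < p.k ∧ x.2.2 < p.k := by
    intro x
    obtain ⟨p, h, hp⟩ := hmeet (.inl (x.1, max x.2.1 x.2.2))
    exact ⟨p, hp, h.1, (le_max_left _ _).trans_lt h.2, (le_max_right _ _).trans_lt h.2⟩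
  choose P hPI hPK hPi hPj using hcov
  let w : G → ℕ → ℕ → ℚ := fun g i j => (P (g, i, j)).w g i j
  -- Directedness makes the value independent of the chosen member of the ideal.
  have hw : ∀ p ∈ 𝓘, ∀ g ∈ p.K, ∀ i < p.k, ∀ j < p.k, w g i j = p.w g i j := by
    intro p hp g hg i hi j hj
    obtain ⟨q, -, hpq, hq⟩ := 𝓘.directed p hp _ (hPI (g, i, j))
    rw [← hpq.2.2 g hg i hi j hj]
    exact (hq.2.2 g (hPK _) i (hPi (g, i, j)) j (hPj (g, i, j))).symm
  have hmet : ∀ p ∈ 𝓘, IsInvMetric p.K (Set.Iio p.k) w := fun p hp =>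
    p.isInvMetric.congr fun g hg i hi j hj => hw p hp g hg i hi j hj
  refine ⟨w, ⟨?_, ?_, ?_⟩, ?_, ?_⟩
  · intro g _ i _ j _
    exact (hmet _ (hPI (g, i, j))).eq_zero_iff g (hPK _) i (hPi (g, i, j)) j (hPj (g, i, j))
  · intro g _ i _ j _
    exact (hmet _ (hPI (g, i, j))).symm g (hPK _) i (hPi (g, i, j)) j (hPj (g, i, j))
  · intro g _ h _ i _ j _ k _
    obtain ⟨q, hqI, h1, h2⟩ := 𝓘.directed _ (hPI (g, i, j)) _ (hPI (h, j, k))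
    exact (hmet q hqI).triangle g (h1.1 (hPK _)) h (h2.1 (hPK _)) i
      ((hPi (g, i, j)).trans_le h1.2.1) j ((hPj (g, i, j)).trans_le h1.2.1) k
      ((hPj (h, j, k)).trans_le h2.2.1)
  · intro A _ s W f hW hne hk
    obtain ⟨S, rfl⟩ := exists_finset_closure_eq A
    obtain ⟨s', hs'⟩ := exists_finsupp_eqOn (Set.toFinite (Subgroup.closure (S : Set G) : Set G)) s
    obtain ⟨f', hf'⟩ := exists_finsupp_eqOn hW f
    lift W to Finset (G × ℕ) using hW
    obtain ⟨p, ⟨hSp, hWp, hp⟩, hpI⟩ := hmeet (.inr (.inl (S, s', W, f')))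
    simp only at hSp hWp hp
    obtain ⟨n, hn, h1, h2⟩ := hp (Finset.coe_nonempty.1 hne) (hk.congr (fun x hx y hy =>
      (hw p hpI _ (mul_mem (inv_mem (hWp x hx).1) (hWp y hy).1) _ (hWp x hx).2 _ (hWp y hy).2).symm)
      hs' hf')
    refine ⟨n, fun a ha => ?_, fun x hx => ?_⟩
    · rw [hw p hpI a (hSp ha) n hn n hn, h1 a ha, hs' a ha]
    · rw [hw p hpI _ (hWp x hx).1 n hn _ (hWp x hx).2, h2 x hx, hf' x hx]
  · intro A B _ I e hAB hI hne he hwe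
    have : Finite A := Finite.of_injective _ (Subgroup.inclusion_injective hAB)
    obtain ⟨S, rfl⟩ := exists_finset_closure_eq A
    obtain ⟨T, rfl⟩ := exists_finset_closure_eq B
    obtain ⟨e', he'⟩ := exists_finsupp_eqOn
      ((Set.toFinite (Subgroup.closure (T : Set G) : Set G)).prod (hI.prod hI))
      (fun x => e x.1 x.2.1 x.2.2)
    have he'' : ∀ g ∈ Subgroup.closure (T : Set G), ∀ i ∈ I, ∀ j ∈ I, e' (g, i, j) = e g i j :=
      fun g hg i hi j hj => he' (g, i, j) ⟨hg, hi, hj⟩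
    lift I to Finset ℕ using hI
    obtain ⟨p, ⟨hSp, hIp, hp⟩, hpI⟩ := hmeet (.inr (.inr (S, T, I, e')))
    simp only at hSp hIp hp
    obtain ⟨τ, h1, h2⟩ := hp (Finset.coe_nonempty.1 hne) hAB (he.congr he'')
      (fun a ha i hi j hj => by
        rw [he'' a (hAB ha) i hi j hj, ← hwe a ha i hi j hj,
          hw p hpI a (hSp ha) i (hIp i hi) j (hIp j hj)])
    refine ⟨τ, h1, fun b i hi j hj => ?_⟩
    rw [hw p hpI _ (h2 b).1 i (hIp i hi) j (hIp j hj), (h2 b).2 i hi j hj, he'' b b.2 i hi j hj]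

/-! ### Characterization and uniqueness of the rational Urysohn space -/

namespace IsRationalUrysohnSpace

theorem of_isometryEquiv {X Y : Type*} [MetricSpace X] [MetricSpace Y] (e : X ≃ᵢ Y)
    (h : IsRationalUrysohnSpace X) : IsRationalUrysohnSpace Y where
  countable := by
    have := h.countable
    exact Countable.of_equiv X e.toEquiv
  rational x y := by
    obtain ⟨q, hq⟩ := h.rational (e.symm x) (e.symm y)
    exact ⟨q, by rw [← hq, e.symm.dist_eq]⟩
  extension A B _ _ _ _ hA hB ι ρ hι hρ := by
    obtain ⟨σ, hσ, h'⟩ := h.extension A B hA hB ι (e.symm ∘ ρ) hι (e.symm.isometry.comp hρ)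
    refine ⟨e ∘ σ, e.isometry.comp hσ, ?_⟩
    rw [Function.comp_assoc, h']
    funext a
    simp

/-- The one-point extension property characterizes the rational Urysohn space. -/
theorem of_onePoint {D : Type*} [MetricSpace D] [Countable D] [Nonempty D]
    (hrat : HasRationalDistances D)
    (h : ∀ (W : Set D) (f : D → ℚ), W.Finite → W.Nonempty → (∀ x ∈ W, 0 < f x) →
      (∀ x ∈ W, ∀ y ∈ W, (f x : ℝ) ≤ f y + dist y x) →
      (∀ x ∈ W, ∀ y ∈ W, dist x y ≤ (f x + f y : ℝ)) → ∃ z, ∀ x ∈ W, dist z x = f x) :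
    IsRationalUrysohnSpace D where
  countable := inferInstance
  rational := hrat
  extension A B _ _ _ _ _ hB ι ρ hι hρ := by
    classical
    choose q hq using hB
    -- Points of `B` are added one by one; `σ` is total but controlled only on `S` and the range of
    -- `ι`.
    have key : ∀ S : Set B, S.Finite → ∃ σ : B → D, (∀ a, σ (ι a) = ρ a) ∧
        ∀ x ∈ S ∪ Set.range ι, ∀ y ∈ S ∪ Set.range ι, dist (σ x) (σ y) = dist x y := by
      intro S hS
      induction S, hS using Set.Finite.induction_on with
      | empty =>
        obtain ⟨d⟩ := ‹Nonempty D›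
        refine ⟨Function.extend ι ρ fun _ => d, fun a => hι.injective.extend_apply _ _ _, ?_⟩
        rintro _ (⟨⟨⟩⟩ | ⟨a, rfl⟩) _ (⟨⟨⟩⟩ | ⟨b, rfl⟩)
        rw [hι.injective.extend_apply, hι.injective.extend_apply, hρ.dist_eq, hι.dist_eq]
      | @insert b S hbS hS ih =>
        obtain ⟨σ, h1, h2⟩ := ih
        rw [Set.insert_union]
        set T := S ∪ Set.range ι with hT
        by_cases hb : b ∈ T
        · rw [Set.insert_eq_of_mem hb]
          exact ⟨σ, h1, h2⟩
        have hTfin : T.Finite := Set.toFinite _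
        have hinj : Set.InjOn σ T := fun x hx y hy hxy => by
          rw [← dist_eq_zero, ← h2 x hx y hy, hxy, dist_self]
        obtain ⟨z, hz⟩ : ∃ z, ∀ x ∈ T, dist z (σ x) = dist b x := by
          rcases T.eq_empty_or_nonempty with h0 | hne
          · rw [h0]
            exact ⟨Classical.arbitrary D, by simp⟩
          have : Nonempty B := ⟨b⟩
          have hf : ∀ x ∈ T, (q b (Function.invFunOn σ T (σ x)) : ℝ) = dist b x := fun x hx => by
            rw [hinj.leftInvOn_invFunOn hx, hq]
          obtain ⟨z, hz⟩ := h (σ '' T) (fun d => q b (Function.invFunOn σ T d)) (hTfin.image σ)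
            (hne.image σ) (by
              rintro _ ⟨x, hx, rfl⟩
              have := hf x hx
              have h3 : 0 < dist b x := dist_pos.2 fun h => hb (h ▸ hx)
              rw [← this] at h3
              exact_mod_cast h3) (by
              rintro _ ⟨x, hx, rfl⟩ _ ⟨y, hy, rfl⟩
              rw [hf x hx, hf y hy, h2 y hy x hx]
              exact dist_triangle _ _ _) (by
              rintro _ ⟨x, hx, rfl⟩ _ ⟨y, hy, rfl⟩
              rw [hf x hx, hf y hy, h2 x hx y hy]
              exact dist_triangle_left _ _ _)
          exact ⟨z, fun x hx => (hz _ ⟨x, hx, rfl⟩).trans (hf x hx)⟩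
        have hne : ∀ x ∈ T, x ≠ b := fun x hx h => hb (h ▸ hx)
        refine ⟨Function.update σ b z, fun a => ?_, ?_⟩
        · rw [Function.update_of_ne (hne _ (Or.inr ⟨a, rfl⟩)), h1]
        · rintro x (rfl | hx) y (rfl | hy)
          · simp
          · rw [Function.update_self, Function.update_of_ne (hne _ hy), hz y hy]
          · rw [Function.update_self, Function.update_of_ne (hne _ hx), dist_comm, hz x hx, dist_comm]
          · rw [Function.update_of_ne (hne _ hx), Function.update_of_ne (hne _ hy), h2 x hx y hy]
    obtain ⟨σ, h1, h2⟩ := key Set.univ Set.finite_univ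
    exact ⟨σ, Isometry.of_dist_eq fun x y => h2 x (Or.inl trivial) y (Or.inl trivial), funext h1⟩

/-- Finite partial isometries between two metric spaces. -/
abbrev FinPartialIsometry (X Y : Type*) [MetricSpace X] [MetricSpace Y] : Type _ :=
  {R : Finset (X × Y) // ∀ p ∈ R, ∀ q ∈ R, dist p.1 q.1 = dist p.2 q.2}

/-- The extension property is applied to the domain of `R` with and without `x`; equality of
distances makes `R` single-valued. -/
theorem exists_insert {X Y : Type} [MetricSpace X] [MetricSpace Y] (hX : HasRationalDistances X)
    (hY : IsRationalUrysohnSpace Y) (R : Finset (X × Y))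
    (hR : ∀ p ∈ R, ∀ q ∈ R, dist p.1 q.1 = dist p.2 q.2) (x : X) :
    ∃ y, ∀ p ∈ R, dist x p.1 = dist y p.2 := by
  classical
  let A : Finset X := R.image Prod.fst
  have hA : ∀ a : A, ∃ y, ((a : X), y) ∈ R := fun a => by
    obtain ⟨p, hp, h⟩ := Finset.mem_image.1 a.2
    exact ⟨p.2, h ▸ hp⟩
  choose ρ hρ using hA
  obtain ⟨σ, hσ, hσρ⟩ := hY.extension A (insert x A : Finset X) (fun _ _ => hX _ _)
    (fun _ _ => hX _ _) (fun a => ⟨a, Finset.mem_insert_of_mem a.2⟩) ρ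
    (Isometry.of_dist_eq fun _ _ => rfl)
    (Isometry.of_dist_eq fun a b => (hR _ (hρ a) _ (hρ b)).symm)
  refine ⟨σ ⟨x, Finset.mem_insert_self _ _⟩, fun p hp => ?_⟩
  have hpA : p.1 ∈ A := Finset.mem_image_of_mem _ hp
  have h1 : ρ ⟨p.1, hpA⟩ = p.2 := by
    rw [← dist_eq_zero, ← hR _ (hρ ⟨p.1, hpA⟩) _ hp, dist_self]
  have h2 : σ ⟨p.1, Finset.mem_insert_of_mem hpA⟩ = ρ ⟨p.1, hpA⟩ := congrFun hσρ ⟨p.1, hpA⟩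
  rw [← h1, ← h2, hσ.dist_eq]
  rfl

/-- Back-and-forth: finite partial isometries can be extended by a point on either side, and an
ideal meeting all these requirements is the graph of the isometry. -/
theorem exists_isometry_surjective {X Y : Type} [MetricSpace X] [MetricSpace Y]
    (hX : IsRationalUrysohnSpace X) (hY : IsRationalUrysohnSpace Y) :
    ∃ F : X → Y, Isometry F ∧ Function.Surjective F := by
  classical
  have := hX.countable
  have := hY.countable
  have c1 : ∀ x, IsCofinal {R : FinPartialIsometry X Y | ∃ y, (x, y) ∈ R.1} := by
    rintro x ⟨R, hR⟩
    obtain ⟨y, hy⟩ := exists_insert hX.rational hY R hR x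
    refine ⟨⟨insert (x, y) R, ?_⟩, ⟨y, Finset.mem_insert_self _ _⟩, Finset.subset_insert _ _⟩
    intro p hp q hq
    rcases Finset.mem_insert.1 hp with rfl | hp <;> rcases Finset.mem_insert.1 hq with rfl | hq
    · simp
    · exact hy q hq
    · rw [dist_comm, hy p hp, dist_comm]
    · exact hR p hp q hq
  have c2 : ∀ y, IsCofinal {R : FinPartialIsometry X Y | ∃ x, (x, y) ∈ R.1} := by
    rintro y ⟨R, hR⟩
    obtain ⟨x, hx⟩ := exists_insert hY.rational hX (R.image Prod.swap) (by
      simp only [Finset.mem_image]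
      rintro _ ⟨p, hp, rfl⟩ _ ⟨q, hq, rfl⟩
      exact (hR p hp q hq).symm) y
    have hx' : ∀ p ∈ R, dist x p.1 = dist y p.2 := fun p hp =>
      (hx _ (Finset.mem_image_of_mem _ hp)).symm
    refine ⟨⟨insert (x, y) R, ?_⟩, ⟨x, Finset.mem_insert_self _ _⟩, Finset.subset_insert _ _⟩
    intro p hp q hq
    rcases Finset.mem_insert.1 hp with rfl | hp <;> rcases Finset.mem_insert.1 hq with rfl | hq
    · simp
    · exact hx' q hq
    · rw [dist_comm, hx' p hp, dist_comm]
    · exact hR p hp q hq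
  let 𝒟 : X ⊕ Y → Order.Cofinal (FinPartialIsometry X Y) :=
    Sum.elim (fun x => ⟨_, c1 x⟩) (fun y => ⟨_, c2 y⟩)
  have : Encodable (X ⊕ Y) := Encodable.ofCountable _
  let p₀ : FinPartialIsometry X Y := ⟨∅, by simp⟩
  let 𝓘 := Order.idealOfCofinals p₀ 𝒟
  have hdist : ∀ p q : X × Y, (∃ R ∈ 𝓘, p ∈ R.1) → (∃ R ∈ 𝓘, q ∈ R.1) →
      dist p.1 q.1 = dist p.2 q.2 := by
    rintro p q ⟨R, hR, hp⟩ ⟨S, hS, hq⟩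
    obtain ⟨T, -, hRT, hST⟩ := 𝓘.directed R hR S hS
    exact T.2 p (hRT hp) q (hST hq)
  have h1 : ∀ x, ∃ y, ∃ R ∈ 𝓘, (x, y) ∈ R.1 := fun x => by
    obtain ⟨R, ⟨y, hy⟩, hR⟩ := Order.cofinal_meets_idealOfCofinals p₀ 𝒟 (.inl x)
    exact ⟨y, R, hR, hy⟩
  have h2 : ∀ y, ∃ x, ∃ R ∈ 𝓘, (x, y) ∈ R.1 := fun y => by
    obtain ⟨R, ⟨x, hx⟩, hR⟩ := Order.cofinal_meets_idealOfCofinals p₀ 𝒟 (.inr y)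
    exact ⟨x, R, hR, hx⟩
  choose F hF using h1
  refine ⟨F, Isometry.of_dist_eq fun x y => (hdist _ _ (hF x) (hF y)).symm, fun y => ?_⟩
  obtain ⟨x, hx⟩ := h2 y
  refine ⟨x, ?_⟩
  rw [← dist_eq_zero, ← hdist _ _ (hF x) hx, dist_self]

end IsRationalUrysohnSpace

/-! ### The generic metric as a dense part of the Urysohn space -/

/-- The metric on `G × ι` given by an invariant metric. -/
@[reducible] noncomputable def IsInvMetric.metricSpace {G ι : Type*} [Group G] {w : G → ι → ι → ℚ}
    (hw : IsInvMetric ⊤ Set.univ w) : MetricSpace (G × ι) where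
  dist x y := ((invDist w x y : ℚ) : ℝ)
  dist_self x := by
    rw [hw.dist_self trivial, Rat.cast_zero]
  dist_comm x y := by
    rw [hw.dist_comm ⟨trivial, trivial⟩ ⟨trivial, trivial⟩]
  dist_triangle x y z := by
    exact_mod_cast hw.dist_triangle (x := x) (y := y) (z := z) ⟨trivial, trivial⟩
      ⟨trivial, trivial⟩ ⟨trivial, trivial⟩
  eq_of_dist_eq_zero {x y} h := by
    have h1 : invDist w x y = 0 := by
      change ((invDist w x y : ℚ) : ℝ) = 0 at h
      exact_mod_cast h
    obtain ⟨h2, h3⟩ := (hw.eq_zero_iff _ trivial _ trivial _ trivial).1 h1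
    exact Prod.ext (inv_mul_eq_one.1 h2) h3

namespace IsGenericInvMetric

variable {G : Type} [Group G] {w : G → ℕ → ℕ → ℚ}

/-- The one-point extension property is the adjunction of an orbit with trivial group; the new point
is `(1, n)`. -/
theorem isRationalUrysohnSpace [Countable G] (hw : IsGenericInvMetric w) :
    @IsRationalUrysohnSpace (G × ℕ) hw.isInvMetric.metricSpace := by
  let := hw.isInvMetric.metricSpace
  have hd : ∀ x y : G × ℕ, dist x y = invDist w x y := fun _ _ => rfl
  refine .of_onePoint (fun x y => ⟨_, hd x y⟩) fun W f hW hne h1 h2 h3 => ?_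
  have hk : IsKatetov (⊥ : Subgroup G) 0 W w f := by
    refine ⟨h1, fun x hx y hy => ?_, fun x hx y hy => ?_, by simp, by simp, fun a ha x hx => ?_,
      by simp, by simp, by simp⟩
    · have := h2 x hx y hy
      rw [hd] at this
      exact_mod_cast this
    · have := h3 x hx y hy
      rw [hd] at this
      exact_mod_cast this
    · rw [Subgroup.mem_bot.1 ha]
      have := h1 x hx
      simp only [Pi.zero_apply, one_mul]
      linarith
  obtain ⟨n, -, hn⟩ := hw.exists_orbit ⊥ 0 W f hW hne hk
  refine ⟨(1, n), fun x hx => ?_⟩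
  rw [hd, ← hn x hx]
  simp [invDist]

theorem exists_isUrysohnSpace [Countable G] (hw : IsGenericInvMetric w) :
    ∃ (U : Type) (_ : MetricSpace U), IsUrysohnSpace U := by
  let := hw.isInvMetric.metricSpace
  refine ⟨UniformSpace.Completion (G × ℕ), inferInstance, inferInstance,
    Set.range ((↑) : G × ℕ → UniformSpace.Completion (G × ℕ)),
    UniformSpace.Completion.denseRange_coe, ?_⟩
  exact .of_isometryEquiv UniformSpace.Completion.coe_isometry.isometryEquivOnRange
    hw.isRationalUrysohnSpace

theorem exists_denseRange [Countable G] (hw : IsGenericInvMetric w) {U : Type*} [MetricSpace U]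
    (hU : IsUrysohnSpace U) :
    ∃ i : G × ℕ → U, DenseRange i ∧ ∀ x y, dist (i x) (i y) = invDist w x y := by
  let := hw.isInvMetric.metricSpace
  obtain ⟨D, hD, hDU⟩ := hU.exists_dense
  have := hDU.countable
  -- The extension property speaks about spaces in `Type`, so the countable `D` is replaced by a
  -- copy there before back-and-forth.
  have : Small.{0} D := Countable.toSmall D
  let u : D ≃ Shrink.{0} D := equivShrink.{0} D
  let : MetricSpace (Shrink.{0} D) := MetricSpace.induced u.symm u.symm.injective inferInstance
  let e : D ≃ᵢ Shrink.{0} D := ⟨u, Isometry.of_dist_eq fun x y => by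
    change dist (u.symm (u x)) (u.symm (u y)) = _
    simp⟩
  obtain ⟨F, hF, hsurj⟩ := hw.isRationalUrysohnSpace.exists_isometry_surjective
    (hDU.of_isometryEquiv e)
  refine ⟨fun x => e.symm (F x), ?_, fun x y => ?_⟩
  · have h1 : Function.Surjective fun x => e.symm (F x) := e.symm.surjective.comp hsurj
    have : Set.range (fun x => (e.symm (F x) : U)) = D := by
      rw [Set.range_comp' Subtype.val, h1.range_eq, Set.image_univ, Subtype.range_coe]
    rw [DenseRange, this]
    exact hD
  · exact (e.symm.isometry.comp hF).dist_eq x y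

end IsGenericInvMetric

/-! ### Embedding invariant metrics into the generic one -/

theorem IsInvMetric.map {H G ι κ : Type*} [Group H] [Group G] {K : Subgroup H} {I : Set ι}
    {v : H → ι → ι → ℚ} (hv : IsInvMetric K I v) (τ : K →* G) (hτ : Function.Injective τ)
    {σ : ι → κ} (hσ : Set.InjOn σ I) {e : G → κ → κ → ℚ}
    (he : ∀ h : K, ∀ i ∈ I, ∀ j ∈ I, e (τ h) (σ i) (σ j) = v h i j) :
    IsInvMetric τ.range (σ '' I) e where
  eq_zero_iff := by
    rintro _ ⟨h, rfl⟩ _ ⟨i, hi, rfl⟩ _ ⟨j, hj, rfl⟩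
    rw [he h i hi j hj, hv.eq_zero_iff h h.2 i hi j hj, map_eq_one_iff τ hτ, hσ.eq_iff hi hj,
      OneMemClass.coe_eq_one]
  symm := by
    rintro _ ⟨h, rfl⟩ _ ⟨i, hi, rfl⟩ _ ⟨j, hj, rfl⟩
    rw [← map_inv, he h i hi j hj, he _ j hj i hi]
    exact hv.symm h h.2 i hi j hj
  triangle := by
    rintro _ ⟨h, rfl⟩ _ ⟨k, rfl⟩ _ ⟨i, hi, rfl⟩ _ ⟨j, hj, rfl⟩ _ ⟨l, hl, rfl⟩
    rw [← map_mul, he h i hi j hj, he k j hj l hl, he _ i hi l hl]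
    exact hv.triangle h h.2 k k.2 i hi j hj l hl

theorem exists_transport {H G ι κ : Type*} [Group H] [Group G] [Nonempty ι] {K : Subgroup H}
    {I : Set ι} (v : H → ι → ι → ℚ) (τ : K →* G) (hτ : Function.Injective τ)
    {σ : ι → κ} (hσ : Set.InjOn σ I) :
    ∃ e : G → κ → κ → ℚ, ∀ h : K, ∀ i ∈ I, ∀ j ∈ I, e (τ h) (σ i) (σ j) = v h i j := by
  refine ⟨fun g i j => v ((Function.invFun τ g : K) : H) (Function.invFunOn σ I i) (Function.invFunOn σ I j),
    fun h i hi j hj => ?_⟩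
  simp only
  rw [Function.leftInverse_invFun hτ, hσ.leftInvOn_invFunOn hi, hσ.leftInvOn_invFunOn hj]

theorem IsKatetov.map {H G ι κ : Type*} [Group H] [Group G] {A : Subgroup H} {s : H → ℚ}
    {I : Set ι} {v : H → ι → ι → ℚ} {f : H × ι → ℚ}
    (h : IsKatetov A s {x | x.1 ∈ A ∧ x.2 ∈ I} v f) (τ : A →* G) (hτ : Function.Injective τ)
    {σ : ι → κ} {w : G → κ → κ → ℚ} {s' : G → ℚ} {f' : G × κ → ℚ}
    (hw : ∀ a : A, ∀ i ∈ I, ∀ j ∈ I, w (τ a) (σ i) (σ j) = v a i j)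
    (hs : ∀ a : A, s' (τ a) = s a) (hf : ∀ a : A, ∀ i ∈ I, f' (τ a, σ i) = f (a, i)) :
    IsKatetov τ.range s' {x | x.1 ∈ τ.range ∧ x.2 ∈ σ '' I} w f' := by
  have hd : ∀ a b : A, ∀ i ∈ I, ∀ j ∈ I,
      invDist w (τ a, σ i) (τ b, σ j) = invDist v ((a : H), i) ((b : H), j) :=
    fun a b i hi j hj => by
      simp only [invDist]
      rw [← map_inv, ← map_mul, hw _ i hi j hj]
      rfl
  refine ⟨?_, ?_, ?_, ?_, ?_, ?_, ?_, ?_, ?_⟩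
  · rintro ⟨_, _⟩ ⟨⟨a, rfl⟩, i, hi, rfl⟩
    rw [hf a i hi]
    exact h.pos _ ⟨a.2, hi⟩
  · rintro ⟨_, _⟩ ⟨⟨a, rfl⟩, i, hi, rfl⟩ ⟨_, _⟩ ⟨⟨b, rfl⟩, j, hj, rfl⟩
    rw [hf a i hi, hf b j hj, hd b a j hj i hi]
    exact h.le_add _ ⟨a.2, hi⟩ _ ⟨b.2, hj⟩
  · rintro ⟨_, _⟩ ⟨⟨a, rfl⟩, i, hi, rfl⟩ ⟨_, _⟩ ⟨⟨b, rfl⟩, j, hj, rfl⟩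
    rw [hf a i hi, hf b j hj, hd a b i hi j hj]
    exact h.dist_le _ ⟨a.2, hi⟩ _ ⟨b.2, hj⟩
  · rintro a ha x ⟨hx, hi⟩
    exact ⟨mul_mem ha hx, hi⟩
  · rintro _ ⟨a, rfl⟩ ⟨_, _⟩ ⟨⟨b, rfl⟩, j, hj, rfl⟩
    simp only
    rw [← map_mul, hf _ j hj, hf _ j hj, hs]
    exact h.smul_le a a.2 (b, j) ⟨b.2, hj⟩
  · rintro _ ⟨a, rfl⟩ ⟨_, _⟩ ⟨⟨b, rfl⟩, j, hj, rfl⟩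
    simp only
    rw [← map_mul, hf _ j hj, hf _ j hj, hs]
    exact h.norm_le a a.2 (b, j) ⟨b.2, hj⟩
  · rintro _ ⟨a, rfl⟩
    rw [hs, map_eq_one_iff τ hτ, ← OneMemClass.coe_eq_one]
    exact h.norm_eq_zero a a.2
  · rintro _ ⟨a, rfl⟩
    rw [← map_inv, hs, hs]
    exact h.norm_inv a a.2
  · rintro _ ⟨a, rfl⟩ _ ⟨b, rfl⟩
    rw [← map_mul, hs, hs, hs]
    exact h.norm_mul a a.2 b b.2

namespace IsGenericInvMetric

variable {G : Type} [Group G] {w : G → ℕ → ℕ → ℚ}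

/-- One step in the construction of an embedding into a generic invariant metric space. -/
theorem exists_extend (hw : IsGenericInvMetric w) (hG : IsHallGroup G) {H : Type} [Group H]
    {v : H → ℕ → ℕ → ℚ} (hv : IsInvMetric ⊤ Set.univ v) {K L : Subgroup H} [Finite L] (hKL : K ≤ L)
    (n : ℕ) (τ : K →* G) (σ : ℕ → ℕ)
    (h : ∀ k : K, ∀ i ≤ n, ∀ j ≤ n, w (τ k) (σ i) (σ j) = v k i j) :
    ∃ (τ' : L →* G) (σ' : ℕ → ℕ), (∀ (k : H) (hk : k ∈ K), τ' ⟨k, hKL hk⟩ = τ ⟨k, hk⟩) ∧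
      (∀ i ≤ n, σ' i = σ i) ∧
      ∀ k : L, ∀ i ≤ n + 1, ∀ j ≤ n + 1, w (τ' k) (σ' i) (σ' j) = v k i j := by
  have hKfin : Finite K := Finite.of_injective _ (Subgroup.inclusion_injective hKL)
  -- Maps preserving the metric are automatically injective, both on the group and on the indices.
  have hinj : ∀ (m : ℕ) (M : Subgroup H) (φ : M →* G) (ρ : ℕ → ℕ),
      (∀ k : M, ∀ i ≤ m, ∀ j ≤ m, w (φ k) (ρ i) (ρ j) = v k i j) →
      Function.Injective φ ∧ Set.InjOn ρ (Set.Iic m) := by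
    intro m M φ ρ hφ
    refine ⟨(injective_iff_map_eq_one φ).2 fun k hk => ?_, fun i hi j hj hij => ?_⟩
    · have h1 := hφ k 0 (Nat.zero_le _) 0 (Nat.zero_le _)
      rw [hk, (hw.isInvMetric.eq_zero_iff 1 trivial _ trivial _ trivial).2 ⟨rfl, rfl⟩] at h1
      exact Subtype.ext ((hv.eq_zero_iff _ trivial _ trivial _ trivial).1 h1.symm).1
    · have h1 := hφ 1 i hi j hj
      rw [hij, map_one,
        (hw.isInvMetric.eq_zero_iff 1 trivial _ trivial _ trivial).2 ⟨rfl, rfl⟩] at h1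
      exact ((hv.eq_zero_iff _ trivial _ trivial _ trivial).1 h1.symm).2
  obtain ⟨hτ, hσ⟩ := hinj n K τ σ h
  -- adding the orbit
  obtain ⟨c, hcc, hci⟩ : ∃ c, (∀ k : K, w (τ k) c c = v k (n + 1) (n + 1)) ∧
      ∀ k : K, ∀ i ≤ n, w (τ k) c (σ i) = v k (n + 1) i := by
    have hk := IsKatetov.of_isInvMetric (A := K) (T := Set.Iic n) (hv.mono le_top le_rfl)
      (Set.subset_univ _) (Set.mem_univ (n + 1)) (by simp)
    have hinv := Function.leftInverse_invFun hτ
    have : Finite τ.range := Set.finite_range τ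
    obtain ⟨c, h1, h2⟩ := hw.exists_orbit τ.range
      (fun g => v ((Function.invFun τ g : K) : H) (n + 1) (n + 1))
      {x | x.1 ∈ τ.range ∧ x.2 ∈ σ '' Set.Iic n}
      (fun x => v ((Function.invFun τ x.1 : K) : H) (n + 1) (Function.invFunOn σ (Set.Iic n) x.2))
      ((Set.toFinite (τ.range : Set G)).prod ((Set.finite_Iic n).image σ))
      ⟨(1, σ 0), one_mem _, 0, Nat.zero_le n, rfl⟩
      (hk.map τ hτ h (fun a => by rw [hinv]) (fun a i hi => by
        simp only [hinv a, hσ.leftInvOn_invFunOn hi]))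
    refine ⟨c, fun k => ?_, fun k i hi => ?_⟩
    · rw [h1 _ ⟨k, rfl⟩, hinv]
    · rw [h2 (τ k, σ i) ⟨⟨k, rfl⟩, i, hi, rfl⟩]
      simp only
      rw [hinv, hσ.leftInvOn_invFunOn hi]
  let σ' : ℕ → ℕ := Function.update σ (n + 1) c
  have hσ'n : σ' (n + 1) = c := Function.update_self ..
  have hσ' : ∀ i ≤ n, σ' i = σ i := fun i hi => Function.update_of_ne (by omega) ..
  have hA : ∀ k : K, ∀ i ≤ n + 1, ∀ j ≤ n + 1, w (τ k) (σ' i) (σ' j) = v k i j := by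
    intro k i hi j hj
    rcases Nat.le_succ_iff.1 hi with hi | rfl <;> rcases Nat.le_succ_iff.1 hj with hj | rfl
    · rw [hσ' i hi, hσ' j hj, h k i hi j hj]
    · rw [hσ' i hi, hσ'n, ← hw.isInvMetric.symm _ trivial _ trivial _ trivial, ← map_inv,
        hci _ i hi, ← hv.symm _ trivial _ trivial _ trivial]
      simp
    · rw [hσ' j hj, hσ'n, hci k j hj]
    · rw [hσ'n, hcc]
  have hσ'inj := (hinj (n + 1) K τ σ' hA).2
  -- enlarging the group
  obtain ⟨ρ, hρ, hρτ⟩ := hG.extension K L (Subgroup.inclusion hKL) τ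
    (Subgroup.inclusion_injective hKL) hτ
  have hρτ' : ∀ k : K, ρ (Subgroup.inclusion hKL k) = τ k := fun k => DFunLike.congr_fun hρτ k
  obtain ⟨e, he⟩ := exists_transport v ρ hρ hσ'inj
  have : Finite ρ.range := Set.finite_range ρ
  -- `ρ` extends `τ` as a homomorphism but ignores the metric. Genericity moves its image over
  -- `τ.range` to a copy of `L` carrying the right distances.
  obtain ⟨φ, hφ, hφe⟩ := hw.exists_hom τ.range ρ.range (σ' '' Set.Iic (n + 1)) e
    (by rintro _ ⟨k, rfl⟩; exact ⟨_, hρτ' k⟩) ((Set.finite_Iic _).image _)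
    ⟨_, 0, Nat.zero_le _, rfl⟩ ((hv.mono le_top (Set.subset_univ _)).map ρ hρ hσ'inj he) (by
      rintro _ ⟨k, rfl⟩ _ ⟨i, hi, rfl⟩ _ ⟨j, hj, rfl⟩
      rw [hA k i hi j hj, ← hρτ', he _ i hi j hj]
      rfl)
  refine ⟨φ.comp ρ.rangeRestrict, σ', fun k hk => ?_, hσ', fun k i hi j hj => ?_⟩
  · have h1 := hφ (ρ.rangeRestrict ⟨k, hKL hk⟩) ⟨⟨k, hk⟩, (hρτ' ⟨k, hk⟩).symm⟩
    exact h1.trans (hρτ' ⟨k, hk⟩)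
  · have h1 := hφe (ρ.rangeRestrict k) _ ⟨i, hi, rfl⟩ _ ⟨j, hj, rfl⟩
    exact h1.trans (he k i hi j hj)

/-- Every invariant rational metric embeds into a generic one. -/
theorem exists_embedding (hw : IsGenericInvMetric w) (hG : IsHallGroup G) {H : Type} [Group H]
    [Countable H] (hH : IsLocallyFiniteGroup H) {v : H → ℕ → ℕ → ℚ}
    (hv : IsInvMetric ⊤ Set.univ v) :
    ∃ (τ : H →* G) (σ : ℕ → ℕ), ∀ h i j, w (τ h) (σ i) (σ j) = v h i j := by
  obtain ⟨enum, henum⟩ := exists_surjective_nat H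
  let K : ℕ → Subgroup H := fun n => Subgroup.closure (enum '' Set.Iio n)
  have hKmono : Monotone K := fun m n hmn =>
    Subgroup.closure_mono (Set.image_mono (Set.Iio_subset_Iio hmn))
  have hKfin : ∀ n, Finite (K n) := fun n => hH _ ⟨((Set.finite_Iio n).image enum).toFinset, by
    simp [K]⟩
  have hK : ∀ h, ∃ n, h ∈ K n := fun h => by
    obtain ⟨n, rfl⟩ := henum h
    exact ⟨n + 1, Subgroup.subset_closure ⟨n, Nat.lt_succ_self n, rfl⟩⟩
  -- Stage `n` consists of a metric-preserving map of the finite group `K n` and the indices up to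
  -- `n`; `K 0` is trivial.
  let X : ℕ → Type := fun n => {x : (K n →* G) × (ℕ → ℕ) //
    ∀ k : K n, ∀ i ≤ n, ∀ j ≤ n, w (x.1 k) (x.2 i) (x.2 j) = v k i j}
  have hstep : ∀ n (x : X n), ∃ y : X (n + 1),
      (∀ k (hk : k ∈ K n), y.1.1 ⟨k, hKmono n.le_succ hk⟩ = x.1.1 ⟨k, hk⟩) ∧
      ∀ i ≤ n, y.1.2 i = x.1.2 i := by
    rintro n ⟨⟨τ, σ⟩, h⟩
    obtain ⟨τ', σ', h1, h2, h3⟩ := hw.exists_extend hG hv (hKmono n.le_succ) n τ σ h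
    exact ⟨⟨(τ', σ'), h3⟩, h1, h2⟩
  choose next hnext1 hnext2 using hstep
  let x₀ : X 0 := ⟨(1, fun i => i), fun k i hi j hj => by
    have hk : (k : H) = 1 := by simpa [K] using k.2
    obtain rfl := Nat.le_zero.1 hi
    obtain rfl := Nat.le_zero.1 hj
    rw [hk, MonoidHom.one_apply, (hv.eq_zero_iff _ trivial _ trivial _ trivial).2 ⟨rfl, rfl⟩,
      (hw.isInvMetric.eq_zero_iff _ trivial _ trivial _ trivial).2 ⟨rfl, rfl⟩]⟩
  let x : ∀ n, X n := fun n => Nat.rec x₀ next n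
  have hx : ∀ n, x (n + 1) = next n (x n) := fun n => rfl
  have h1 : ∀ m n (hmn : m ≤ n) k (hk : k ∈ K m),
      (x n).1.1 ⟨k, hKmono hmn hk⟩ = (x m).1.1 ⟨k, hk⟩ := by
    intro m n hmn k hk
    induction n, hmn using Nat.le_induction with
    | base => rfl
    | succ n hmn ih => rw [hx, hnext1 n (x n) k (hKmono hmn hk), ih]
  have h2 : ∀ m n, m ≤ n → ∀ i ≤ m, (x n).1.2 i = (x m).1.2 i := by
    intro m n hmn i hi
    induction n, hmn using Nat.le_induction with
    | base => rfl
    | succ n hmn ih => rw [hx, hnext2 n (x n) i (hi.trans hmn), ih]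
  choose N hN using hK
  have h1' : ∀ n k (hk : k ∈ K n), (x (N k)).1.1 ⟨k, hN k⟩ = (x n).1.1 ⟨k, hk⟩ := by
    intro n k hk
    rw [← h1 _ _ (le_max_left (N k) n) k (hN k), ← h1 _ _ (le_max_right (N k) n) k hk]
  -- The image of index `i` is final from stage `i` on, and that of `h` from any stage whose group
  -- contains `h`.
  refine ⟨MonoidHom.mk' (fun h => (x (N h)).1.1 ⟨h, hN h⟩) fun g h => ?_, fun i => (x i).1.2 i,
    fun h i j => ?_⟩
  · have hg := hKmono (le_max_left (N g) (N h)) (hN g)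
    have hh := hKmono (le_max_right (N g) (N h)) (hN h)
    rw [h1' _ g hg, h1' _ h hh, h1' _ _ (mul_mem hg hh), ← map_mul]
    rfl
  · have hh := hKmono (le_max_left (N h) (max i j)) (hN h)
    have hi := (le_max_left i j).trans (le_max_right (N h) (max i j))
    have hj := (le_max_right i j).trans (le_max_right (N h) (max i j))
    change w ((x (N h)).1.1 ⟨h, hN h⟩) ((x i).1.2 i) ((x j).1.2 j) = _
    rw [h1' _ h hh, ← h2 i _ hi i le_rfl, ← h2 j _ hj j le_rfl]
    exact (x _).2 ⟨h, hh⟩ i hi j hj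

end IsGenericInvMetric

/-! ### Rational approximation of isometric actions -/

open Filter Topology

/-- Invariant metrics converging in a controlled way form the levels of one invariant metric. -/
theorem IsInvMetric.tower {H ι : Type*} [Group H] {D : ℕ → H → ι → ι → ℚ} {c : ℕ → ℚ}
    (hD : ∀ m, IsInvMetric ⊤ Set.univ (D m)) (hc : StrictAnti c)
    (hanti : ∀ k m, k ≤ m → ∀ h p q, D m h p q ≤ D k h p q)
    (hle : ∀ k m, k ≤ m → ∀ h p q, D k h p q ≤ D m h p q + 2 * (c k - c m)) :
    IsInvMetric ⊤ Set.univ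
      (fun h (x y : ι × ℕ) => |c x.2 - c y.2| + D (max x.2 y.2) h x.1 y.1) where
  eq_zero_iff := by
    rintro h - ⟨p, i⟩ - ⟨q, j⟩ -
    have h1 : 0 ≤ D (max i j) h p q := (hD _).nonneg trivial trivial trivial
    rw [add_eq_zero_iff_of_nonneg (abs_nonneg _) h1, abs_eq_zero, sub_eq_zero, hc.injective.eq_iff,
      (hD _).eq_zero_iff h trivial p trivial q trivial, Prod.mk.injEq]
    tauto
  symm := by
    rintro h - ⟨p, i⟩ - ⟨q, j⟩ -
    simp only
    rw [abs_sub_comm, max_comm, (hD _).symm h trivial p trivial q trivial]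
  triangle := by
    rintro h - h' - ⟨p, i⟩ - ⟨q, j⟩ - ⟨r, k⟩ -
    simp only
    have htri : ∀ m, D m (h * h') p r ≤ D m h p q + D m h' q r := fun m =>
      (hD m).triangle h trivial h' trivial p trivial q trivial r trivial
    rcases le_total j (max i k) with hj | hj
    · have h1 := hanti (max i j) (max i k) (max_le (le_max_left _ _) hj) h p q
      have h2 := hanti (max j k) (max i k) (max_le hj (le_max_right _ _)) h' q r
      have h3 := abs_sub_le (c i) (c j) (c k)
      linarith [htri (max i k)]
    -- A detour through a deeper level `j` has vertical cost `|c i - c k| + 2 * (c (max i k) - c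
    -- j)`; the excess is just what `hle` permits the level distance to drop.
    · have hij : i ≤ j := (le_max_left _ _).trans hj
      have hkj : k ≤ j := (le_max_right _ _).trans hj
      rw [max_eq_right hij, max_eq_left hkj]
      have h1 := hle (max i k) j hj (h * h') p r
      have h2 := hc.antitone hij
      have h3 := hc.antitone hkj
      rw [abs_of_nonneg (sub_nonneg.2 h2), abs_of_nonpos (sub_nonpos.2 h3)]
      have h4 := htri j
      rcases le_total i k with hik | hik
      · rw [max_eq_right hik] at h1 ⊢
        rw [abs_of_nonneg (sub_nonneg.2 (hc.antitone hik))]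
        linarith
      · rw [max_eq_left hik] at h1 ⊢
        rw [abs_of_nonpos (sub_nonpos.2 (hc.antitone hik))]
        linarith

/-- Rounding up to a multiple of `2⁻ᵐ`. -/
noncomputable def dyadicCeil (m : ℕ) (t : ℝ) : ℚ := (⌈2 ^ m * t⌉ : ℚ) / 2 ^ m

theorem dyadicCeil_zero (m : ℕ) : dyadicCeil m 0 = 0 := by simp [dyadicCeil]

theorem le_dyadicCeil (m : ℕ) (t : ℝ) : t ≤ dyadicCeil m t := by
  have h := Int.le_ceil (2 ^ m * t)
  simp only [dyadicCeil]
  push_cast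
  rw [le_div_iff₀ (by positivity)]
  linarith

theorem dyadicCeil_le (m : ℕ) (t : ℝ) : (dyadicCeil m t : ℝ) ≤ t + (1 / 2) ^ m := by
  have h := (Int.ceil_lt_add_one (2 ^ m * t)).le
  simp only [dyadicCeil]
  push_cast
  rw [div_le_iff₀ (by positivity), add_mul, ← mul_pow]
  norm_num
  linarith

theorem dyadicCeil_mono (m : ℕ) {s t : ℝ} (h : s ≤ t) : dyadicCeil m s ≤ dyadicCeil m t := by
  simp only [dyadicCeil]
  gcongr

/-- Rounding up is monotone and subadditive, hence preserves triangle inequalities. -/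
theorem dyadicCeil_add_le (m : ℕ) (s t : ℝ) :
    dyadicCeil m (s + t) ≤ dyadicCeil m s + dyadicCeil m t := by
  simp only [dyadicCeil]
  rw [← add_div, mul_add]
  gcongr
  exact_mod_cast Int.ceil_add_le _ _

theorem dyadicCeil_anti {k m : ℕ} (h : k ≤ m) (t : ℝ) : dyadicCeil m t ≤ dyadicCeil k t := by
  obtain ⟨d, rfl⟩ := Nat.exists_eq_add_of_le h
  simp only [dyadicCeil]
  rw [div_le_div_iff₀ (by positivity) (by positivity)]
  have h1 : ⌈(2 : ℝ) ^ (k + d) * t⌉ ≤ 2 ^ d * ⌈(2 : ℝ) ^ k * t⌉ := by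
    rw [Int.ceil_le]
    push_cast
    rw [pow_add, mul_comm ((2 : ℝ) ^ k), mul_assoc]
    gcongr
    exact Int.le_ceil _
  have h2 : (⌈(2 : ℝ) ^ (k + d) * t⌉ : ℚ) ≤ 2 ^ d * ⌈(2 : ℝ) ^ k * t⌉ := by exact_mod_cast h1
  calc _ ≤ (2 ^ d * ⌈(2 : ℝ) ^ k * t⌉ : ℚ) * 2 ^ k := by gcongr
    _ = _ := by rw [pow_add]; ring

open Classical in
/-- An isometric action is approximated by free actions with rational distances. -/
theorem exists_invMetric_approx {H Y ι : Type*} [Group H] [MetricSpace Y] (β : H →* (Y ≃ᵢ Y))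
    (y : ι → Y) :
    ∃ v : H → ι × ℕ → ι × ℕ → ℚ, IsInvMetric ⊤ Set.univ v ∧
      (∀ p k l, (v 1 (p, k) (p, l) : ℝ) ≤ 2 * (1 / 2) ^ (min k l)) ∧
      ∀ h p q k, dist (y p) (β h (y q)) ≤ v h (p, k) (q, k) ∧
        (v h (p, k) (q, k) : ℝ) ≤ dist (y p) (β h (y q)) + 2 * (1 / 2) ^ k := by
  let δ : H → ι → ι → ℝ := fun h p q => dist (y p) (β h (y q))
  -- This term separates distinct formal points `(h, p)` even where the action or `y` identifies
  -- them.
  let E : ℕ → H → ι → ι → ℚ := fun m h p q => if h = 1 ∧ p = q then 0 else (1 / 2) ^ m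
  let D : ℕ → H → ι → ι → ℚ := fun m h p q => dyadicCeil m (δ h p q) + E m h p q
  -- Consecutive heights differ by `(1 / 2) ^ k`, so for `k < m` the allowance `2 * (c k - c m)`
  -- covers the error `2 * (1 / 2) ^ k` of level `k`.
  let c : ℕ → ℚ := fun m => 2 * (1 / 2) ^ m
  have hc : StrictAnti c := fun a b h =>
    mul_lt_mul_of_pos_left (pow_lt_pow_right_of_lt_one₀ (by norm_num) (by norm_num) h) two_pos
  have hδ0 : ∀ h p q, 0 ≤ δ h p q := fun _ _ _ => dist_nonneg
  have hC0 : ∀ m h p q, 0 ≤ dyadicCeil m (δ h p q) := fun m h p q => by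
    rw [← dyadicCeil_zero m]
    exact dyadicCeil_mono m (hδ0 h p q)
  have hE0 : ∀ m h p q, 0 ≤ E m h p q := fun m h p q => by
    simp only [E]
    split_ifs <;> positivity
  have hE1 : ∀ m h p q, E m h p q ≤ (1 / 2) ^ m := fun m h p q => by
    simp only [E]
    split_ifs
    · positivity
    · rfl
  have hδ1 : ∀ p, δ 1 p p = 0 := fun p => by simp [δ]
  have hDm : ∀ m, IsInvMetric ⊤ Set.univ (D m) := by
    refine fun m => ⟨fun h _ p _ q _ => ?_, fun h _ p _ q _ => ?_, fun h _ h' _ p _ q _ r _ => ?_⟩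
    · simp only [D]
      rw [add_eq_zero_iff_of_nonneg (hC0 _ _ _ _) (hE0 _ _ _ _)]
      constructor
      · rintro ⟨-, h2⟩
        by_contra h3
        simp [E, h3] at h2
      · rintro ⟨rfl, rfl⟩
        simp [E, hδ1, dyadicCeil_zero]
    · have h1 : δ h⁻¹ q p = δ h p q := by
        simp only [δ]
        rw [← (β h).dist_eq, map_inv, IsometryEquiv.apply_inv_self, dist_comm]
      have h2 : (h⁻¹ = 1 ∧ q = p) ↔ (h = 1 ∧ p = q) := by rw [inv_eq_one, eq_comm (a := q)]
      simp only [D, E, h1, h2]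
    · have h1 : δ (h * h') p r ≤ δ h p q + δ h' q r := by
        simp only [δ]
        refine (dist_triangle _ (β h (y q)) _).trans ?_
        rw [map_mul, IsometryEquiv.mul_apply, (β h).dist_eq]
      have h2 : E m (h * h') p r ≤ E m h p q + E m h' q r := by
        by_cases ha : h = 1 ∧ p = q
        · obtain ⟨rfl, rfl⟩ := ha
          simp [E]
        · refine (hE1 _ _ _ _).trans ?_
          have : E m h p q = (1 / 2) ^ m := by simp only [E, ha, if_false]
          rw [this]
          exact le_add_of_nonneg_right (hE0 _ _ _ _)
      have h3 := (dyadicCeil_mono m h1).trans (dyadicCeil_add_le m _ _)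
      simp only [D]
      linarith
  have hD1 : ∀ m h p q, δ h p q ≤ D m h p q := fun m h p q => by
    have h1 := le_dyadicCeil m (δ h p q)
    have h2 : (0 : ℝ) ≤ E m h p q := by exact_mod_cast hE0 m h p q
    simp only [D]
    push_cast
    linarith
  have hD2 : ∀ m h p q, (D m h p q : ℝ) ≤ δ h p q + 2 * (1 / 2) ^ m := fun m h p q => by
    have h1 := dyadicCeil_le m (δ h p q)
    have h2 : (E m h p q : ℝ) ≤ (1 / 2) ^ m := by
      have := (Rat.cast_le (K := ℝ)).2 (hE1 m h p q)
      push_cast at this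
      exact this
    simp only [D]
    push_cast
    linarith
  have hanti : ∀ k m, k ≤ m → ∀ h p q, D m h p q ≤ D k h p q := fun k m hkm h p q => by
    refine add_le_add (dyadicCeil_anti hkm _) ?_
    simp only [E]
    split_ifs
    · rfl
    · exact pow_le_pow_of_le_one (by norm_num) (by norm_num) hkm
  have hle : ∀ k m, k ≤ m → ∀ h p q, D k h p q ≤ D m h p q + 2 * (c k - c m) := by
    intro k m hkm h p q
    rcases hkm.eq_or_lt with rfl | hlt
    · simp
    have h1 : (D k h p q : ℝ) ≤ D m h p q + 2 * (1 / 2) ^ k := by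
      linarith [hD2 k h p q, hD1 m h p q]
    have h1' : D k h p q ≤ D m h p q + 2 * (1 / 2) ^ k := by
      rw [← Rat.cast_le (K := ℝ)]
      push_cast
      exact h1
    have h2 : c m ≤ c (k + 1) := hc.antitone hlt
    simp only [c, pow_succ] at h2 ⊢
    linarith
  refine ⟨_, IsInvMetric.tower hDm hc hanti hle, fun p k l => ?_, fun h p q k => ?_⟩
  · have h0 : D (max k l) 1 p p = 0 :=
      ((hDm _).eq_zero_iff 1 trivial p trivial p trivial).2 ⟨rfl, rfl⟩
    have h1 : |c k - c l| ≤ 2 * (1 / 2) ^ (min k l) := by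
      have hp : ∀ m, 0 ≤ c m := fun m => by positivity
      rcases le_total k l with h | h
      · rw [min_eq_left h, abs_of_nonneg (sub_nonneg.2 (hc.antitone h))]
        linarith [hp l]
      · rw [min_eq_right h, abs_of_nonpos (sub_nonpos.2 (hc.antitone h))]
        linarith [hp k]
    simp only
    rw [h0, add_zero]
    have h2 := (Rat.cast_le (K := ℝ)).2 h1
    push_cast at h2 ⊢
    exact h2
  · simp only [sub_self, abs_zero, max_self, zero_add]
    exact ⟨hD1 k h p q, hD2 k h p q⟩

/-! ### The universal action on the Urysohn space -/

/-- An isometric map defined on a dense set extends to an isometric map. -/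
theorem exists_isometry_extending {α X Z : Type*} [MetricSpace X] [MetricSpace Z]
    [CompleteSpace Z] {a : α → X} (ha : DenseRange a) {b : α → Z}
    (h : ∀ x y, dist (b x) (b y) = dist (a x) (a y)) :
    ∃ F : X → Z, Isometry F ∧ ∀ x, F (a x) = b x := by
  let : PseudoMetricSpace α := PseudoMetricSpace.induced a inferInstance
  have hau : IsUniformInducing a := ⟨rfl⟩
  have hb : Isometry b := Isometry.of_dist_eq h
  have hd : IsDenseInducing a := hau.isDenseInducing ha
  have hcont : Continuous (hd.extend b) :=
    (uniformContinuous_uniformly_extend hau ha hb.uniformContinuous).continuous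
  have hF : ∀ x, hd.extend b (a x) = b x :=
    fun x => uniformly_extend_of_ind hau ha hb.uniformContinuous x
  refine ⟨hd.extend b, Isometry.of_dist_eq fun x y => ?_, hF⟩
  refine ha.induction_on₂ (p := fun x y => dist (hd.extend b x) (hd.extend b y) = dist x y)
    (isClosed_eq (by fun_prop) (by fun_prop)) (fun x y => ?_) x y
  rw [hF, hF, h]

/-- Left translations preserve `invDist`, so they extend to `U` by completeness; the group laws hold
on a dense set and thus everywhere. -/
theorem exists_isometric_action {G ι U : Type*} [Group G] [MetricSpace U] [CompleteSpace U]
    {w : G → ι → ι → ℚ} {i : G × ι → U} (hi : DenseRange i)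
    (hd : ∀ x y, dist (i x) (i y) = invDist w x y) :
    ∃ γ : G →* (U ≃ᵢ U), ∀ g x, γ g (i x) = i (g * x.1, x.2) := by
  have h : ∀ g : G, ∃ F : U → U, Isometry F ∧ ∀ x, F (i x) = i (g * x.1, x.2) := fun g =>
    exists_isometry_extending hi fun x y => by rw [hd, hd, invDist_smul]
  choose F hF hFi using h
  have hmul : ∀ g h x, F (g * h) x = F g (F h x) := fun g h => by
    refine hi.equalizer (hF _).continuous ((hF g).continuous.comp (hF h).continuous) ?_ |> congrFun
    funext x
    simp [hFi, mul_assoc]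
  have hone : ∀ x, F 1 x = x := by
    refine hi.equalizer (hF _).continuous continuous_id ?_ |> congrFun
    funext x
    simp [hFi]
  let e : G → (U ≃ᵢ U) := fun g =>
    ⟨⟨F g, F g⁻¹, fun x => by rw [← hmul, inv_mul_cancel, hone],
      fun x => by rw [← hmul, mul_inv_cancel, hone]⟩, hF g⟩
  exact ⟨MonoidHom.mk' e fun g h => IsometryEquiv.ext (hmul g h), hFi⟩

/-- Hall's group acts on the Urysohn space universally. -/
theorem exists_universal_action {G : Type} [Group G] (hG : IsHallGroup G)
    {U : Type*} [MetricSpace U] (hU : IsUrysohnSpace U) :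
    ∃ γ : G →* (U ≃ᵢ U), ∀ (H : Type) [Group H] [Countable H], IsLocallyFiniteGroup H →
      ∀ (Y : Type*) [MetricSpace Y] [Nonempty Y] [TopologicalSpace.SeparableSpace Y]
        (β : H →* (Y ≃ᵢ Y)), ∃ (τ : H →* G) (F : Y → U), Function.Injective τ ∧ Isometry F ∧
          ∀ h y, F (β h y) = γ (τ h) (F y) := by
  have := hG.countable
  have := hU.complete
  obtain ⟨w, hw⟩ := hG.exists_isGenericInvMetric
  obtain ⟨i, hi, hd⟩ := hw.exists_denseRange hU
  obtain ⟨γ, hγ⟩ := exists_isometric_action hi hd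
  refine ⟨γ, fun H _ _ hH Y _ _ _ β => ?_⟩
  let y := TopologicalSpace.denseSeq Y
  have hy : DenseRange y := TopologicalSpace.denseRange_denseSeq Y
  obtain ⟨v, hv, hv1, hv2⟩ := exists_invMetric_approx β y
  have hunpair : Function.Injective Nat.unpair := Nat.pairEquiv.symm.injective
  -- The pairs (point, level) are coded by natural numbers.
  obtain ⟨τ, σ, hτσ⟩ := hw.exists_embedding hG hH
    (v := fun h m n => v h (Nat.unpair m) (Nat.unpair n))
    ⟨fun h _ m _ n _ => by
        rw [hv.eq_zero_iff h trivial _ trivial _ trivial, hunpair.eq_iff],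
      fun h _ m _ n _ => hv.symm h trivial _ trivial _ trivial,
      fun h _ k _ m _ n _ l _ => hv.triangle h trivial k trivial _ trivial _ trivial _ trivial⟩
  -- `x (h, p) k` is the level `k` approximation to the image of `β h (y p)`; its limit `Q (h, p)`
  -- is that image.
  let x : H × ℕ → ℕ → U := fun a k => i (τ a.1, σ (Nat.pair a.2 k))
  have hx : ∀ a b k l, dist (x a k) (x b l) = v (a.1⁻¹ * b.1) (a.2, k) (b.2, l) := fun a b k l => by
    simp only [x, hd, invDist]
    rw [← map_inv, ← map_mul, hτσ, Nat.unpair_pair, Nat.unpair_pair]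
  have h0 : Tendsto (fun k : ℕ => 2 * (1 / 2 : ℝ) ^ k) atTop (𝓝 0) := by
    simpa using (tendsto_pow_atTop_nhds_zero_of_lt_one (r := (1 / 2 : ℝ)) (by norm_num)
      (by norm_num)).const_mul 2
  have hlim : ∀ a, ∃ z, Tendsto (x a) atTop (𝓝 z) := fun a => by
    refine cauchySeq_tendsto_of_complete (cauchySeq_of_le_tendsto_0 (fun k => 2 * (1 / 2 : ℝ) ^ k)
      (fun k l N hk hl => ?_) h0)
    rw [hx, inv_mul_cancel]
    refine (hv1 a.2 k l).trans ?_
    gcongr ?_ * ?_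
    exact pow_le_pow_of_le_one (by norm_num) (by norm_num) (le_min hk hl)
  choose Q hQ using hlim
  have hQd : ∀ a b, dist (Q a) (Q b) = dist (β a.1 (y a.2)) (β b.1 (y b.2)) := fun a b => by
    have h1 : Tendsto (fun k => dist (x a k) (x b k)) atTop (𝓝 (dist (Q a) (Q b))) :=
      (hQ a).dist (hQ b)
    have h2 : dist (β a.1 (y a.2)) (β b.1 (y b.2)) =
        dist (y a.2) (β (a.1⁻¹ * b.1) (y b.2)) := by
      rw [← (β a.1).dist_eq (y a.2), ← IsometryEquiv.mul_apply, ← map_mul, mul_inv_cancel_left]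
    rw [h2]
    refine tendsto_nhds_unique h1 ?_
    refine tendsto_of_tendsto_of_tendsto_of_le_of_le tendsto_const_nhds
      (h := fun k => dist (y a.2) (β (a.1⁻¹ * b.1) (y b.2)) + 2 * (1 / 2 : ℝ) ^ k)
      (by simpa using h0.const_add (dist (y a.2) (β (a.1⁻¹ * b.1) (y b.2)))) (fun k => ?_)
      (fun k => ?_)
    · simp only [hx]
      exact (hv2 _ _ _ k).1
    · simp only [hx]
      exact (hv2 _ _ _ k).2
  have hdense : DenseRange fun a : H × ℕ => β a.1 (y a.2) := by
    refine hy.mono ?_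
    rintro _ ⟨p, rfl⟩
    exact ⟨(1, p), by simp⟩
  obtain ⟨F, hF, hFQ⟩ := exists_isometry_extending hdense hQd
  refine ⟨τ, F, (injective_iff_map_eq_one τ).2 fun h hh => ?_, hF, fun h => ?_⟩
  -- The approximating metric is a genuine one, so `τ` is injective even if `β` is not faithful.
  · have h1 := hτσ h 0 0
    rw [hh, (hw.isInvMetric.eq_zero_iff 1 trivial _ trivial _ trivial).2 ⟨rfl, rfl⟩] at h1
    exact ((hv.eq_zero_iff h trivial _ trivial _ trivial).1 h1.symm).1
  · refine hdense.equalizer (hF.continuous.comp (β h).continuous)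
      ((γ (τ h)).continuous.comp hF.continuous) ?_ |> congrFun
    funext a
    have h1 : β h (β a.1 (y a.2)) = β (h * a.1, a.2).1 (y (h * a.1, a.2).2) := by
      simp
    have h2 : Tendsto (fun k => γ (τ h) (x a k)) atTop (𝓝 (γ (τ h) (Q a))) :=
      ((γ (τ h)).continuous.tendsto _).comp (hQ a)
    simp only [Function.comp_apply]
    rw [h1, hFQ, hFQ]
    refine tendsto_nhds_unique (hQ _) (h2.congr fun k => ?_)
    simp only [x]
    rw [hγ, map_mul]

/-! ### Affine isometries of the Lipschitz-free space -/

namespace LipZero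

variable {X : Type*} [MetricSpace X] {o : X}

/-- Precomposition with an isometry, corrected to vanish at the base point. -/
noncomputable def compIsometry (T : X ≃ᵢ X) : LipZero X o →L[ℝ] LipZero X o :=
  LinearMap.mkContinuous
    { toFun := fun f => ⟨fun x => f (T x) - f (T o), by simp, ⟨‖f‖, norm_nonneg f⟩,
        LipschitzWith.of_dist_le_mul fun x y => by
          rw [dist_sub_right, Real.dist_eq, ← T.dist_eq x y]
          exact f.abs_sub_le _ _⟩
      map_add' := fun f g => ext_apply fun x => add_sub_add_comm _ _ _ _
      map_smul' := fun c f => ext_apply fun x => (mul_sub _ _ _).symm } 1 fun f => by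
    rw [one_mul]
    refine norm_le (norm_nonneg f) fun x y => ?_
    rw [← T.dist_eq x y]
    change |f (T x) - f (T o) - (f (T y) - f (T o))| ≤ _
    rw [sub_sub_sub_cancel_right]
    exact f.abs_sub_le _ _

theorem norm_compIsometry_le (T : X ≃ᵢ X) : ‖(compIsometry T : LipZero X o →L[ℝ] _)‖ ≤ 1 :=
  LinearMap.mkContinuous_norm_le _ zero_le_one _

theorem compIsometry_one : (compIsometry 1 : LipZero X o →L[ℝ] _) = .id ℝ _ :=
  ContinuousLinearMap.ext fun f => ext_apply fun x => by
    change f x - f o = f x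
    rw [apply_base, sub_zero]

theorem compIsometry_mul (S T : X ≃ᵢ X) :
    (compIsometry (S * T) : LipZero X o →L[ℝ] _) = (compIsometry T).comp (compIsometry S) :=
  ContinuousLinearMap.ext fun f => ext_apply fun x => by
    change f (S (T x)) - f (S (T o)) = f (S (T x)) - f (S o) - (f (S (T o)) - f (S o))
    ring

theorem eval_comp_compIsometry (T : X ≃ᵢ X) (x : X) :
    (eval o x).comp (compIsometry T) = eval o (T x) - eval o (T o) := rfl

/-- The lower bound is attained by the distance to `y`, shifted to vanish at the base point. -/
theorem norm_eval_sub (x y : X) : ‖eval o x - eval o y‖ = dist x y := by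
  refine le_antisymm (ContinuousLinearMap.opNorm_le_bound _ dist_nonneg fun f => ?_) ?_
  · rw [mul_comm]
    exact f.abs_sub_le x y
  · let f : LipZero X o := ⟨fun z => dist z y - dist o y, by simp, 1,
      LipschitzWith.of_dist_le_mul fun a b => by
        rw [dist_sub_right, NNReal.coe_one, one_mul]
        exact abs_dist_sub_le a b y⟩
    have hf : ‖f‖ ≤ 1 := norm_le zero_le_one fun a b => by
      change |dist a y - dist o y - (dist b y - dist o y)| ≤ _
      rw [sub_sub_sub_cancel_right, one_mul]
      exact abs_dist_sub_le a b y
    have h1 : (eval o x - eval o y) f = dist x y := by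
      change dist x y - dist o y - (dist y y - dist o y) = dist x y
      rw [dist_self]
      ring
    calc dist x y = ‖(eval o x - eval o y) f‖ := by
          rw [h1, Real.norm_of_nonneg dist_nonneg]
      _ ≤ ‖eval o x - eval o y‖ * ‖f‖ := ContinuousLinearMap.le_opNorm _ _
      _ ≤ ‖eval o x - eval o y‖ * 1 := by gcongr
      _ = _ := mul_one _

end LipZero

/-- The affine isometry with the given linear part and the given value at zero. -/
noncomputable def LinearIsometryEquiv.addConst {E : Type*} [NormedAddCommGroup E] [NormedSpace ℝ E]
    (v : E) (L : E ≃ₗᵢ[ℝ] E) : AffineIsometryGroup E :=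
  L.toAffineIsometryEquiv.trans (AffineIsometryEquiv.constVAdd ℝ E v)

namespace LipschitzFreeSpace

open LipZero

variable {X : Type*} [MetricSpace X] {o : X}

theorem comp_compIsometry_mem (T : X ≃ᵢ X) {φ : StrongDual ℝ (LipZero X o)}
    (hφ : φ ∈ (Submodule.span ℝ (Set.range (eval o))).topologicalClosure) :
    φ.comp (compIsometry T) ∈ (Submodule.span ℝ (Set.range (eval o))).topologicalClosure := by
  have hc : Continuous fun φ : StrongDual ℝ (LipZero X o) => φ.comp (compIsometry T) :=
    ((ContinuousLinearMap.compL ℝ _ _ ℝ).flip (compIsometry T)).continuous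
  have hspan : ∀ ψ ∈ Submodule.span ℝ (Set.range (eval o)),
      ψ.comp (compIsometry T) ∈ Submodule.span ℝ (Set.range (eval o)) := fun ψ hψ => by
    induction hψ using Submodule.span_induction with
    | mem ψ h =>
      obtain ⟨x, rfl⟩ := h
      rw [eval_comp_compIsometry]
      exact sub_mem (Submodule.subset_span ⟨_, rfl⟩) (Submodule.subset_span ⟨_, rfl⟩)
    | zero => rw [ContinuousLinearMap.zero_comp]; exact zero_mem _
    | add a b _ _ ha hb => rw [ContinuousLinearMap.add_comp]; exact add_mem ha hb
    | smul c a _ ha => rw [ContinuousLinearMap.smul_comp]; exact Submodule.smul_mem _ _ ha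
  exact map_mem_closure (f := fun φ : StrongDual ℝ (LipZero X o) => φ.comp (compIsometry T))
    hc hφ hspan

/-- The canonical embedding of a metric space into its Lipschitz-free space. -/
noncomputable def embed (o x : X) : LipschitzFreeSpace X o :=
  ⟨eval o x, subset_closure (Submodule.subset_span ⟨x, rfl⟩)⟩

theorem isometry_embed : Isometry (embed o) :=
  Isometry.of_dist_eq fun x y => by
    change dist (eval o x) (eval o y) = _
    rw [dist_eq_norm, norm_eval_sub]

/-- The linear map of the Lipschitz-free space induced by an isometry. -/
noncomputable def linearMap (T : X ≃ᵢ X) : LipschitzFreeSpace X o →ₗ[ℝ] LipschitzFreeSpace X o where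
  toFun φ := ⟨φ.1.comp (compIsometry T), comp_compIsometry_mem T φ.2⟩
  map_add' _ _ := rfl
  map_smul' _ _ := rfl

theorem linearMap_one (φ : LipschitzFreeSpace X o) : linearMap 1 φ = φ :=
  Subtype.ext (by
    change φ.1.comp (compIsometry 1) = φ.1
    rw [compIsometry_one, ContinuousLinearMap.comp_id])

theorem linearMap_mul (S T : X ≃ᵢ X) (φ : LipschitzFreeSpace X o) :
    linearMap (S * T) φ = linearMap S (linearMap T φ) :=
  Subtype.ext (by
    change φ.1.comp (compIsometry (S * T)) = (φ.1.comp (compIsometry T)).comp (compIsometry S)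
    rw [compIsometry_mul, ContinuousLinearMap.comp_assoc])

theorem linearMap_embed (T : X ≃ᵢ X) (x : X) :
    linearMap T (embed o x) = embed o (T x) - embed o (T o) := rfl

theorem norm_linearMap_le (T : X ≃ᵢ X) (φ : LipschitzFreeSpace X o) : ‖linearMap T φ‖ ≤ ‖φ‖ := by
  refine (ContinuousLinearMap.opNorm_comp_le _ _).trans ?_
  exact mul_le_of_le_one_right (norm_nonneg _) (norm_compIsometry_le T)

/-- The linear isometry of the Lipschitz-free space induced by an isometry. -/
noncomputable def linearIsometryEquiv (T : X ≃ᵢ X) :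
    LipschitzFreeSpace X o ≃ₗᵢ[ℝ] LipschitzFreeSpace X o where
  toLinearEquiv := LinearEquiv.ofLinearMap (linearMap T) (linearMap T⁻¹)
    (LinearMap.ext fun φ => by
      rw [LinearMap.comp_apply, ← linearMap_mul, mul_inv_cancel, linearMap_one, LinearMap.id_apply])
    (LinearMap.ext fun φ => by
      rw [LinearMap.comp_apply, ← linearMap_mul, inv_mul_cancel, linearMap_one, LinearMap.id_apply])
  norm_map' φ := by
    refine le_antisymm (norm_linearMap_le T φ) ?_
    have h := norm_linearMap_le T⁻¹ (linearMap T φ)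
    rw [← linearMap_mul, inv_mul_cancel, linearMap_one] at h
    exact h

/-- The affine action of the isometry group on the Lipschitz-free space. -/
noncomputable def affineAction (o : X) : (X ≃ᵢ X) →* AffineIsometryGroup (LipschitzFreeSpace X o) :=
  MonoidHom.mk' (fun T => (linearIsometryEquiv T).addConst (embed o (T o))) fun S T => by
    ext1 φ
    change embed o (S (T o)) + linearMap (S * T) φ =
      embed o (S o) + linearMap S (embed o (T o) + linearMap T φ)
    rw [map_add, linearMap_embed, linearMap_mul]
    abel

/-- The linear part moves the base point back to the origin, and the translation part undoes exactly
this. -/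
theorem affineAction_embed (T : X ≃ᵢ X) (x : X) :
    affineAction o T (embed o x) = embed o (T x) := by
  change embed o (T o) + linearMap T (embed o x) = _
  rw [linearMap_embed]
  abel

end LipschitzFreeSpace

/-! ### Existence of Hall's group -/

/-- The stages of the construction of Hall's group: each is the symmetric group of the previous. -/
def HallStage : ℕ → Type
  | 0 => Fin 3
  | n + 1 => Equiv.Perm (HallStage n)

namespace HallStage

instance finite : ∀ n, Finite (HallStage n)
  | 0 => inferInstanceAs (Finite (Fin 3))
  | n + 1 => have := finite n; inferInstanceAs (Finite (Equiv.Perm (HallStage n)))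

theorem card_succ (n : ℕ) : Nat.card (HallStage (n + 1)) = (Nat.card (HallStage n)).factorial :=
  Nat.card_perm

/-- Three initial points suffice since `m < m!` for `m ≥ 3`, whereas 1 and 2 equal their factorials.
Growth makes every order eventually divide the size of a stage. -/
theorem add_three_le_card (n : ℕ) : n + 3 ≤ Nat.card (HallStage n) := by
  induction n with
  | zero => exact (Nat.card_eq_fintype_card (α := Fin 3)).ge
  | succ n ih =>
    rw [card_succ]
    have := Nat.lt_factorial_self (show 3 ≤ Nat.card (HallStage n) by omega)
    omega

/-- The Cayley embedding of a stage of Hall's group into the next one. -/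
def cayley (n : ℕ) : Equiv.Perm (HallStage n) →* Equiv.Perm (HallStage (n + 1)) :=
  MulAction.toPermHom (Equiv.Perm (HallStage n)) (Equiv.Perm (HallStage n))

theorem eq_one_of_cayley_apply_eq {n : ℕ} (g : Equiv.Perm (HallStage n)) (e : HallStage (n + 1))
    (h : cayley n g e = e) : g = 1 :=
  (mul_eq_right (M := Equiv.Perm (HallStage n)) (b := e)).1 h

theorem cayley_injective (n : ℕ) : Function.Injective (cayley n) :=
  (injective_iff_map_eq_one _).2 fun g hg =>
    eq_one_of_cayley_apply_eq g (1 : Equiv.Perm (HallStage n)) (by rw [hg]; rfl)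

/-- The embeddings between the stages of Hall's group. -/
def map (i j : ℕ) (h : i ≤ j) : Equiv.Perm (HallStage i) →* Equiv.Perm (HallStage j) :=
  Nat.leRec (motive := fun j _ => Equiv.Perm (HallStage i) →* Equiv.Perm (HallStage j))
    (MonoidHom.id _) (fun j _ g => (cayley j).comp g) h

theorem map_self (i : ℕ) : map i i le_rfl = MonoidHom.id _ := Nat.leRec_self _ _

theorem map_succ {i j : ℕ} (h : i ≤ j) : map i (j + 1) (h.trans j.le_succ) = (cayley j).comp (map i j h) :=
  Nat.leRec_succ _ _ _

theorem map_injective (i j : ℕ) (h : i ≤ j) : Function.Injective (map i j h) := by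
  induction j, h using Nat.le_induction with
  | base => rw [map_self]; exact Function.injective_id
  | succ j h ih =>
    rw [map_succ h]
    exact (cayley_injective j).comp ih

instance directedSystem : DirectedSystem (fun n => Equiv.Perm (HallStage n)) (map · · ·) where
  map_self i x := by rw [map_self, MonoidHom.id_apply]
  map_map k j i hij hjk x := by
    induction k, hjk using Nat.le_induction with
    | base => rw [map_self, MonoidHom.id_apply]
    | succ k hjk ih =>
      rw [map_succ hjk, map_succ (hij.trans hjk), MonoidHom.comp_apply, MonoidHom.comp_apply, ih]

end HallStage

/-- The direct limit of the stages of Hall's group. -/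
abbrev HallLimit : Type := DirectLimit (fun n => Equiv.Perm (HallStage n)) HallStage.map

namespace HallLimit

/-- The embedding of a stage into the direct limit. -/
noncomputable def ofStage (n : ℕ) : Equiv.Perm (HallStage n) →* HallLimit :=
  MonoidHom.mk' (fun x => Quotient.mk _ ⟨n, x⟩) fun x y => 
    (DirectLimit.mul_def (G := fun n => Equiv.Perm (HallStage n)) (f := HallStage.map) n x y).symm

theorem ofStage_injective (n : ℕ) : Function.Injective (ofStage n) :=
  DirectLimit.mk_injective _ HallStage.map_injective n

theorem ofStage_map {i j : ℕ} (h : i ≤ j) (x : Equiv.Perm (HallStage i)) :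
    ofStage j (HallStage.map i j h x) = ofStage i x :=
  DirectLimit.mk_apply (F := fun n => Equiv.Perm (HallStage n)) (f := HallStage.map) i j x h

theorem ofStage_cayley (n : ℕ) (x : Equiv.Perm (HallStage n)) :
    ofStage (n + 1) (HallStage.cayley n x) = ofStage n x := by
  have h := ofStage_map n.le_succ x
  rwa [show HallStage.map n n.succ n.le_succ = _ from HallStage.map_succ le_rfl,
    HallStage.map_self] at h

theorem range_ofStage_mono {i j : ℕ} (h : i ≤ j) : (ofStage i).range ≤ (ofStage j).range := by
  rintro _ ⟨x, rfl⟩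
  exact ⟨_, ofStage_map h x⟩

theorem exists_subset_range {s : Set HallLimit} (hs : s.Finite) (N : ℕ) :
    ∃ n, N ≤ n ∧ s ⊆ (ofStage n).range := by
  induction s, hs using Set.Finite.induction_on with
  | empty => exact ⟨N, le_rfl, Set.empty_subset _⟩
  | @insert a s _ _ ih =>
    obtain ⟨n, hn, hsn⟩ := ih
    obtain ⟨i, x, rfl⟩ := DirectLimit.exists_eq_mk _ a
    refine ⟨max n i, hn.trans (le_max_left _ _), Set.insert_subset ?_ ?_⟩
    · exact range_ofStage_mono (le_max_right n i) ⟨x, rfl⟩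
    · exact hsn.trans (range_ofStage_mono (le_max_left n i))

instance countable : Countable HallLimit :=
  inferInstanceAs (Countable (Quotient (DirectLimit.setoid HallStage.map)))

/-- Finitely many elements lie in one stage. There the smaller group acts freely on the next stage
by the Cayley embedding, and far enough out its size, a factorial, is divisible by the order of `B`;
so the action extends to `B`. -/
theorem isHallGroup : IsHallGroup HallLimit where
  countable := countable
  locallyFinite := by
    rintro K ⟨S, rfl⟩
    obtain ⟨n, -, hn⟩ := exists_subset_range S.finite_toSet 0
    have hle : Subgroup.closure (S : Set HallLimit) ≤ (ofStage n).range :=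
      (Subgroup.closure_le _).2 hn
    have : Finite (ofStage n).range := Set.finite_range (ofStage n)
    exact Finite.of_injective _ (Subgroup.inclusion_injective hle)
  extension := by
    intro A B _ _ _ _ ι ρ hι hρ
    obtain ⟨n, hBn, hn⟩ := exists_subset_range (Set.finite_range ρ) (Nat.card B)
    let ε := MonoidHom.ofInjective (ofStage_injective n)
    let ρ' : A →* Equiv.Perm (HallStage n) :=
      ε.symm.toMonoidHom.comp (ρ.codRestrict _ fun a => hn ⟨a, rfl⟩)
    have hρ' : ∀ a, ofStage n (ρ' a) = ρ a := fun a =>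
      congrArg Subtype.val (ε.apply_symm_apply ⟨ρ a, hn ⟨a, rfl⟩⟩)
    have hd : Nat.card B ∣ Nat.card (HallStage (n + 1)) := by
      rw [HallStage.card_succ]
      have := HallStage.add_three_le_card n
      exact Nat.dvd_factorial Nat.card_pos (by omega)
    obtain ⟨σ, hσ, hfree⟩ := exists_perm_hom_extending ι hι ((HallStage.cayley n).comp ρ')
      (fun a e h => hρ (by
        rw [← hρ', HallStage.eq_one_of_cayley_apply_eq _ e h, map_one, map_one])) hd
    refine ⟨(ofStage (n + 1)).comp σ, (ofStage_injective _).comp ?_, MonoidHom.ext fun a => ?_⟩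
    · refine (injective_iff_map_eq_one _).2 fun b hb =>
        hfree b (1 : Equiv.Perm (HallStage n)) (by rw [hb]; rfl)
    · rw [MonoidHom.comp_apply, MonoidHom.comp_apply, hσ, MonoidHom.comp_apply, ofStage_cayley, hρ']

end HallLimit

/-! ### Transport along isomorphisms and conclusion -/

theorem IsLocallyFiniteGroup.of_injective {G H : Type*} [Group G] [Group H]
    (hG : IsLocallyFiniteGroup G) (f : H →* G) (hf : Function.Injective f) :
    IsLocallyFiniteGroup H := fun K hK =>
  have := hG (K.map f) (by
    classical
    obtain ⟨S, rfl⟩ := hK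
    exact ⟨S.image f, by rw [Finset.coe_image, MonoidHom.map_closure]⟩)
  Finite.of_injective _ (K.equivMapOfInjective f hf).injective

theorem IsHallGroup.of_mulEquiv {G H : Type*} [Group G] [Group H] (hG : IsHallGroup G)
    (e : H ≃* G) : IsHallGroup H where
  countable := have := hG.countable; e.injective.countable
  locallyFinite := hG.locallyFinite.of_injective e.toMonoidHom e.injective
  extension A B _ _ _ _ ι ρ hι hρ := by
    obtain ⟨σ, hσ, h⟩ := hG.extension A B ι (e.toMonoidHom.comp ρ) hι (e.injective.comp hρ)
    refine ⟨e.symm.toMonoidHom.comp σ, e.symm.injective.comp hσ, MonoidHom.ext fun a => ?_⟩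
    exact (congrArg e.symm (DFunLike.congr_fun h a)).trans (e.symm_apply_apply _)

theorem mainTheorem10 :
    (∃ (G : Type) (_ : Group G), IsHallGroup G) ∧
    (∃ (U : Type) (_ : MetricSpace U), IsUrysohnSpace U) ∧
    ∀ (G : Type*) [Group G] (U : Type*) [MetricSpace U] (o : U),
      IsHallGroup G → IsUrysohnSpace U →
      ∃ α : G →* AffineIsometryGroup (LipschitzFreeSpace U o),
        ∀ (H : Type*) [Group H] [Countable H], IsLocallyFiniteGroup H →
        ∀ (Y : Type*) [NormedAddCommGroup Y] [NormedSpace ℝ Y] [CompleteSpace Y]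
          [TopologicalSpace.SeparableSpace Y] (β : H →* (Y ≃ᵢ Y)),
          ∃ (H' : Subgroup G) (e : H ≃* H') (j : Y → LipschitzFreeSpace U o),
            Isometry j ∧ ∀ (h : H) (y : Y), j (β h y) = α (e h : G) (j y) := by
  refine ⟨⟨HallLimit, inferInstance, HallLimit.isHallGroup⟩, ?_, ?_⟩
  · obtain ⟨w, hw⟩ := HallLimit.isHallGroup.exists_isGenericInvMetric
    exact hw.exists_isUrysohnSpace
  intro G _ U _ o hG hU
  have := hG.countable
  -- The countable groups are replaced by copies in `Type`, where the universal action was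
  -- constructed.
  have : Small.{0} G := Countable.toSmall G
  let s : Shrink.{0} G ≃* G := Shrink.mulEquiv
  obtain ⟨γ, hγ⟩ := exists_universal_action (hG.of_mulEquiv s) hU
  refine ⟨(LipschitzFreeSpace.affineAction o).comp (γ.comp s.symm.toMonoidHom), ?_⟩
  intro H _ _ hH Y _ _ _ _ β
  have : Small.{0} H := Countable.toSmall H
  let t : Shrink.{0} H ≃* H := Shrink.mulEquiv
  have : Countable (Shrink.{0} H) := t.injective.countable
  obtain ⟨τ, F, hτ, hF, hτF⟩ := hγ (Shrink.{0} H) (hH.of_injective t.toMonoidHom t.injective) Y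
    (β.comp t.toMonoidHom)
  let ε : H →* G := s.toMonoidHom.comp (τ.comp t.symm.toMonoidHom)
  have hε : Function.Injective ε := s.injective.comp (hτ.comp t.symm.injective)
  refine ⟨ε.range, MonoidHom.ofInjective hε, LipschitzFreeSpace.embed o ∘ F,
    LipschitzFreeSpace.isometry_embed.comp hF, fun h y => ?_⟩
  have h1 : F (β h y) = γ (τ (t.symm h)) (F y) := by
    rw [← hτF, MonoidHom.comp_apply]
    exact congrArg (fun k => F (β k y)) (t.apply_symm_apply h).symm
  change LipschitzFreeSpace.embed o (F (β h y)) =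
    LipschitzFreeSpace.affineAction o (γ (s.symm (s (τ (t.symm h))))) (LipschitzFreeSpace.embed o (F y))
  rw [s.symm_apply_apply, LipschitzFreeSpace.affineAction_embed, h1]
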